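/- Let $\Omega\subset\mathbb R^2$ be a bounded open set and $\Delta=\partial_{11}+\partial_{22}$. For $k\in[1,\infty]$ and $\varepsilon\in(0,1]$ let $\mathcal D_{k,\varepsilon}$ be the set of functions $u\in W^{2,k}(\Omega)\cap C^{1,\varepsilon}(\bar\Omega)$ with $u=0$ on $\partial\Omega$, where $u\in C^{1,\varepsilon}(\bar\Omega)$ means that $u$ is continuous on $\bar\Omega$, differentiable in $\Omega$, and $\nabla u$ extends to an $\varepsilon$-Hölder continuous field on $\bar\Omega$. (1) (Gradient bound.) For all $1\le q<2$ and $C\ge 0$ there is a constant $C_q=C_q(\Omega,q,C)$ such that every $u\in\bigcup_{k,\varepsilon}\mathcal D_{k,\varepsilon}$ with $\int_\Omega|\Delta u|\,dx\le C$ satisfies $\|\nabla u\|_{L^q(\Omega)}\le C_q$. In particular this holds uniformly in $i$ for any sequence $(u_i)$ of such functions. (2) (Duality.) For every $p\in(2,\infty]$ there is a constant $K=K(\Omega,p)$ such that for every vector field $f\in L^{p}(\Omega;\mathbb R^2)$ the equation $-\Delta z=\operatorname{div} f$ has a weak solution $z\in W^{1,2}_0(\Omega)$, i.e. $\int_\Omega\nabla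 z\cdot\nabla\varphi\,dx=-\int_\Omega f\cdot\nabla\varphi\,dx$ for all $\varphi\in C_c^\infty(\Omega)$, and every such solution satisfies $\|z\|_{L^\infty(\Omega)}\le K\|f\|_{L^{p}(\Omega)}$ and, for every $u\in\bigcup_{k,\varepsilon}\mathcal D_{k,\varepsilon}$, $$\int_\Omega f\cdot\nabla u\,dx=-\int_\Omega\nabla z\cdot\nabla u\,dx=\int_\Omega z\,\Delta u\,dx .$$ (3) (Brezis–Merle setting.) Fix $k,\varepsilon,b,C$ and let $u_i\in\mathcal D_{k,\varepsilon}$ solve $-\Delta u_i=V_ie^{u_i}$ in $\Omega$, with $V_i$ measurable, $0\le V_i\le b$ a.e. and $\int_\Omega e^{u_i}dx\le C$ for all $i$. (a) Let $1\le q<2$ and let $u\in L^1_{loc}(\Omega)$ have a weak gradient $\nabla u\in L^1_{loc}(\Omega)$. If $\|\nabla(u_i-u)\|_{L^q(S)}\to0$ for every compact $S\subset\Omega$, then $\|\nabla(u_i-u)\|_{L^q(\Omega)}\to0$. (b) There are a subsequence $(u_{s(i)})$ and a function $u$ such that, for all $1\le q<2$, $u\in W^{1,q}_0(\Omega)$,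 $\|u_{s(i)}-u\|_{L^q(\Omega)}\to0$ and $\|\nabla(u_{s(i)}-u)\|_{L^q(\Omega)}\to0$. -/

import Mathlib

open MeasureTheory Filter Topology Set TopologicalSpace
open scoped NNReal ENNReal Distributions Laplacian

/-- The Euclidean plane `ℝ²`. -/
abbrev Plane : Type := EuclideanSpace ℝ (Fin 2)

/-- Lebesgue measure on the open set `Ω`. -/
noncomputable abbrev volOn (Ω : Opens Plane) : Measure Plane :=
  volume.restrict (Ω : Set Plane)

/-- `G` is the gradient of `u` on `Ω` in the sense of distributions:
`∫_Ω u ∂_v φ = - ∫_Ω (G · v) φ` for all test functions `φ` and all directions `v`. -/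
def HasWeakGradient (Ω : Opens Plane) (u : Plane → ℝ) (G : Plane → Plane) : Prop :=
  LocallyIntegrableOn u (Ω : Set Plane) volume ∧
  LocallyIntegrableOn G (Ω : Set Plane) volume ∧
  ∀ (φ : 𝓓(Ω, ℝ)) (v : Plane),
    ∫ x in (Ω : Set Plane), u x * inner ℝ (gradient φ x) v =
      - ∫ x in (Ω : Set Plane), inner ℝ (G x) v * φ x

/-- `L = Δu = ∂₁₁u + ∂₂₂u` on `Ω` in the sense of distributions. -/
def HasWeakLaplacian (Ω : Opens Plane) (u L : Plane → ℝ) : Prop :=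
  LocallyIntegrableOn u (Ω : Set Plane) volume ∧
  LocallyIntegrableOn L (Ω : Set Plane) volume ∧
  ∀ φ : 𝓓(Ω, ℝ),
    ∫ x in (Ω : Set Plane), u x * Δ (φ : Plane → ℝ) x =
      ∫ x in (Ω : Set Plane), L x * φ x

/-- `u ∈ W^{1,p}(Ω)` with weak gradient `G`. -/
def MemW1 (Ω : Opens Plane) (p : ℝ≥0∞) (u : Plane → ℝ) (G : Plane → Plane) : Prop :=
  MemLp u p (volOn Ω) ∧ MemLp G p (volOn Ω) ∧ HasWeakGradient Ω u G

/-- `u ∈ W_0^{1,p}(Ω)` with weak gradient `G`: the closure of the test functions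
in `W^{1,p}(Ω)`. -/
def MemW10 (Ω : Opens Plane) (p : ℝ≥0∞) (u : Plane → ℝ) (G : Plane → Plane) : Prop :=
  MemW1 Ω p u G ∧
  ∃ φ : ℕ → 𝓓(Ω, ℝ),
    Tendsto (fun n => eLpNorm (fun x => φ n x - u x) p (volOn Ω)) atTop (𝓝 0) ∧
    Tendsto (fun n => eLpNorm (fun x => gradient (φ n) x - G x) p (volOn Ω)) atTop (𝓝 0)

/-- `u ∈ W^{2,p}(Ω)`: `u ∈ W^{1,p}(Ω)` and each first weak derivative is in `W^{1,p}(Ω)`. -/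
def MemW2 (Ω : Opens Plane) (p : ℝ≥0∞) (u : Plane → ℝ) : Prop :=
  ∃ G : Plane → Plane, MemW1 Ω p u G ∧
    ∀ j : Fin 2, ∃ H : Plane → Plane, MemW1 Ω p (fun x => G x j) H

/-- `u ∈ C^{1,ε}(Ω̄)`: `u` is continuous on `Ω̄`, differentiable in `Ω`, and its gradient
extends to an `ε`-Hölder continuous vector field on `Ω̄`. -/
def MemC1Holder (Ω : Opens Plane) (ε : ℝ≥0) (u : Plane → ℝ) : Prop :=
  ContinuousOn u (closure (Ω : Set Plane)) ∧
  ∃ D : Plane → Plane, (∀ x ∈ Ω, HasGradientAt u (D x) x) ∧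
    ∃ M : ℝ≥0, HolderOnWith M ε D (closure (Ω : Set Plane))

/-- `u ∈ W^{2,k}(Ω) ∩ C^{1,ε}(Ω̄)` and `u = 0` on `∂Ω`. -/
def DirichletClass (Ω : Opens Plane) (k : ℝ≥0∞) (ε : ℝ≥0) (u : Plane → ℝ) : Prop :=
  MemW2 Ω k u ∧ MemC1Holder Ω ε u ∧ ∀ x ∈ frontier (Ω : Set Plane), u x = 0

/-- `z ∈ W_0^{1,2}(Ω)`, with weak gradient `Z`, is a weak solution of `-Δz = div f` in `Ω`. -/
def IsDivSolution (Ω : Opens Plane) (f : Plane → Plane) (z : Plane → ℝ) (Z : Plane → Plane) :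
    Prop :=
  MemW10 Ω 2 z Z ∧
  ∀ φ : 𝓓(Ω, ℝ),
    ∫ x in (Ω : Set Plane), inner ℝ (Z x) (gradient φ x) =
      - ∫ x in (Ω : Set Plane), inner ℝ (f x) (gradient φ x)

/-- The Dirichlet problem of Brezis and Merle: `-Δu = V e^u` in `Ω`, `u = 0` on `∂Ω`,
with `0 ≤ V ≤ b` and `∫_Ω e^u ≤ C`. -/
def IsBrezisMerleSolution (Ω : Opens Plane) (k : ℝ≥0∞) (ε : ℝ≥0) (b C : ℝ≥0)
    (V u : Plane → ℝ) : Prop :=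
  DirichletClass Ω k ε u ∧
  AEStronglyMeasurable V (volOn Ω) ∧
  (∀ᵐ x ∂(volOn Ω), 0 ≤ V x ∧ V x ≤ b) ∧
  HasWeakLaplacian Ω u (fun x => -(V x * Real.exp (u x))) ∧
  ∫⁻ x in (Ω : Set Plane), ENNReal.ofReal (Real.exp (u x)) ≤ C

/-!
Only three facts about `u ∈ DirichletClass Ω k ε` matter: `u ∈ W_0^{1,2}(Ω)`, `-Δu = g` weakly, and
`g ∈ L¹(Ω)`. They allow testing the equation with `ψ(u)` for every bounded smooth `ψ` with
`ψ(0) = 0` and bounded derivative, so that `∫ ψ'(u) |∇u|² ≤ sup |ψ| ‖g‖₁`.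

*Gradient bound.* With `ψ' = (1 + t²)^{-3/4}` this bounds `∇v` in `L²` for the function
`v = ∫₀ᵘ (1 + s²)^{-3/8} ds`. In the plane the Sobolev inequality then bounds `v` in every `L^m`
with `m < ∞`. As `|u|` is at most a polynomial in `|v|`, Hölder's inequality bounds
`∇u = (1 + u²)^{3/8} ∇v` in `L^q` for all `q < 2`.

*Duality.* If `-Δz = div f`, `f ∈ L^p` with `p > 2`, and `-Δu = g` with `g` bounded, then
`∫ z g = -∫ f · ∇u ≤ ‖f‖_p ‖∇u‖_{p'}`, where `p' < 2`, and the gradient bound turns this into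
`|∫ z g| ≤ K ‖f‖_p ‖g‖₁`, that is `‖z‖_∞ ≤ K ‖f‖_p`.

*Convergence.* Since the gradients are bounded in `L^r` for some `r > q`, they do not concentrate
near `∂Ω`, so that interior convergence in `L^q` is global. For compactness, Rellich's theorem gives
a subsequence converging in `L²`. Testing the equation for a difference `w` of two of its terms with
`δ arctan(w / δ)`, where `δ = ‖w‖₂`, bounds `‖∇w‖₁` by a multiple of `δ^{1/2}`: the gradients are
Cauchy in `L¹`, hence converge in every `L^q` with `q < 2`.
-/

section LpConvergence

variable {ι α E : Type*} [MeasurableSpace α] {μ : Measure α} [NormedAddCommGroup E] {l : Filter ι}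

theorem tendsto_eLpNorm_of_dominated {p : ℝ≥0∞} (hp0 : p ≠ 0) (hp : p ≠ ∞) {F : ℕ → α → E}
    {b : α → ℝ} (hF : ∀ n, AEStronglyMeasurable (F n) μ) (hb : MemLp b p μ)
    (hle : ∀ n, ∀ᵐ x ∂μ, ‖F n x‖ ≤ b x)
    (hlim : ∀ᵐ x ∂μ, Tendsto (fun n => F n x) atTop (𝓝 0)) :
    Tendsto (fun n => eLpNorm (F n) p μ) atTop (𝓝 0) := by
  have hp' : 0 < p.toReal := ENNReal.toReal_pos hp0 hp
  have hpow : Tendsto (fun n => ∫⁻ x, ‖F n x‖ₑ ^ p.toReal ∂μ) atTop (𝓝 0) := by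
    rw [← lintegral_zero (μ := μ)]
    refine tendsto_lintegral_of_dominated_convergence' (fun x => ‖b x‖ₑ ^ p.toReal)
      (fun n => (hF n).enorm.pow_const _) (fun n => ?_)
      (lintegral_rpow_enorm_lt_top_of_eLpNorm_lt_top hp0 hp hb.2).ne ?_
    · filter_upwards [hle n] with x hx
      gcongr
      exact enorm_le_iff_norm_le.2 (hx.trans (le_abs_self _))
    · filter_upwards [hlim] with x hx
      simpa [hp'] using hx.enorm.ennrpow_const p.toReal
  simp only [eLpNorm_eq_lintegral_rpow_enorm_toReal hp0 hp]
  simpa [hp'] using hpow.ennrpow_const (1 / p.toReal)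

theorem exists_eLpNorm_le_mul_eLpNorm_of_exponent_le [IsFiniteMeasure μ] {p q : ℝ≥0∞} (hp : p ≠ 0)
    (hpq : p ≤ q) : ∃ c : ℝ≥0, ∀ f : α → E, AEStronglyMeasurable f μ →
      eLpNorm f p μ ≤ c * eLpNorm f q μ := by
  have hexp : 0 ≤ 1 / p.toReal - 1 / q.toReal := by
    rcases eq_or_ne q ∞ with rfl | hq
    · simp
    · exact sub_nonneg.2 (one_div_le_one_div_of_le
        (ENNReal.toReal_pos hp (hpq.trans_lt hq.lt_top).ne) (ENNReal.toReal_mono hq hpq))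
  refine ⟨(μ univ ^ (1 / p.toReal - 1 / q.toReal)).toNNReal, fun f hf => ?_⟩
  rw [ENNReal.coe_toNNReal (ENNReal.rpow_ne_top_of_nonneg hexp (measure_ne_top _ _)), mul_comm]
  exact eLpNorm_le_eLpNorm_mul_rpow_measure_univ hpq hf

theorem tendsto_eLpNorm_of_exponent_le [IsFiniteMeasure μ] {p q : ℝ≥0∞} (hp : p ≠ 0) (hpq : p ≤ q)
    {F : ι → α → E} (hF : ∀ n, AEStronglyMeasurable (F n) μ)
    (h : Tendsto (fun n => eLpNorm (F n) q μ) l (𝓝 0)) :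
    Tendsto (fun n => eLpNorm (F n) p μ) l (𝓝 0) := by
  obtain ⟨c, hc⟩ := exists_eLpNorm_le_mul_eLpNorm_of_exponent_le (E := E) (μ := μ) hp hpq
  have hbound : Tendsto (fun n => c * eLpNorm (F n) q μ) l (𝓝 0) := by
    simpa using ENNReal.Tendsto.const_mul h (.inr ENNReal.coe_ne_top)
  exact tendsto_nhds_bot_mono' hbound fun n => hc _ (hF n)

theorem tendsto_eLpNorm_of_norm_le_mul {E' : Type*} [NormedAddCommGroup E'] {p : ℝ≥0∞}
    {F : ι → α → E} {G : ι → α → E'} (hG : Tendsto (fun n => eLpNorm (G n) p μ) l (𝓝 0)) (c : ℝ)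
    (hle : ∀ n, ∀ᵐ x ∂μ, ‖F n x‖ ≤ c * ‖G n x‖) :
    Tendsto (fun n => eLpNorm (F n) p μ) l (𝓝 0) := by
  have hbound : Tendsto (fun n => ENNReal.ofReal c * eLpNorm (G n) p μ) l (𝓝 0) := by
    simpa using ENNReal.Tendsto.const_mul hG (.inr ENNReal.ofReal_ne_top)
  exact tendsto_nhds_bot_mono' hbound fun n => eLpNorm_le_mul_eLpNorm_of_ae_le_mul (hle n) p

theorem tendsto_eLpNorm_of_norm_le_add {E' E'' : Type*} [NormedAddCommGroup E']
    [NormedAddCommGroup E''] {p : ℝ≥0∞} (hp : 1 ≤ p) {F : ι → α → E} {G : ι → α → E'}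
    {H : ι → α → E''} (hGm : ∀ n, AEStronglyMeasurable (G n) μ)
    (hHm : ∀ n, AEStronglyMeasurable (H n) μ) (hG : Tendsto (fun n => eLpNorm (G n) p μ) l (𝓝 0))
    (hH : Tendsto (fun n => eLpNorm (H n) p μ) l (𝓝 0))
    (hle : ∀ n, ∀ᵐ x ∂μ, ‖F n x‖ ≤ ‖G n x‖ + ‖H n x‖) :
    Tendsto (fun n => eLpNorm (F n) p μ) l (𝓝 0) := by
  have hbound : Tendsto (fun n => eLpNorm (G n) p μ + eLpNorm (H n) p μ) l (𝓝 0) := by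
    simpa using hG.add hH
  refine tendsto_nhds_bot_mono' hbound fun n => (eLpNorm_mono_ae_real (hle n)).trans ?_
  exact (eLpNorm_add_le (hGm n).norm (hHm n).norm hp).trans_eq (by simp only [eLpNorm_norm])

variable [InnerProductSpace ℝ E] {p q : ℝ≥0∞} [p.HolderConjugate q] {F V : α → E}

theorem eLpNorm_inner_le (hF : AEStronglyMeasurable F μ) (hV : AEStronglyMeasurable V μ) :
    eLpNorm (fun x => inner ℝ (F x) (V x)) 1 μ ≤ eLpNorm F p μ * eLpNorm V q μ := by
  simpa using eLpNorm_le_eLpNorm_mul_eLpNorm_of_nnnorm (p := p) (q := q) (r := 1) hF hV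
    (fun x y => inner ℝ x y) 1 (.of_forall fun x => by simpa using nnnorm_inner_le_nnnorm _ _)

theorem integrable_inner_of_memLp (hF : MemLp F p μ) (hV : MemLp V q μ) :
    Integrable (fun x => inner ℝ (F x) (V x)) μ :=
  memLp_one_iff_integrable.1 ⟨hF.1.inner hV.1,
    (eLpNorm_inner_le hF.1 hV.1).trans_lt (ENNReal.mul_lt_top hF.2 hV.2)⟩

theorem enorm_integral_inner_le (hF : AEStronglyMeasurable F μ) (hV : AEStronglyMeasurable V μ) :
    ‖∫ x, inner ℝ (F x) (V x) ∂μ‖ₑ ≤ eLpNorm F p μ * eLpNorm V q μ :=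
  (enorm_integral_le_lintegral_enorm _).trans
    (by rw [← eLpNorm_one_eq_lintegral_enorm]; exact eLpNorm_inner_le hF hV)

theorem tendsto_integral_inner {G : ι → α → E} (hF : MemLp F p μ) (hG : ∀ n, MemLp (G n) q μ)
    (hV : MemLp V q μ) (h : Tendsto (fun n => eLpNorm (fun x => G n x - V x) q μ) l (𝓝 0)) :
    Tendsto (fun n => ∫ x, inner ℝ (F x) (G n x) ∂μ) l (𝓝 (∫ x, inner ℝ (F x) (V x) ∂μ)) := by
  refine tendsto_integral_of_L1' _ (integrable_inner_of_memLp hF hV).aestronglyMeasurable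
    (.of_forall fun n => integrable_inner_of_memLp hF (hG n)) ?_
  have hbound : Tendsto (fun n => eLpNorm F p μ * eLpNorm (fun x => G n x - V x) q μ) l (𝓝 0) := by
    simpa using ENNReal.Tendsto.const_mul h (.inr hF.2.ne)
  refine tendsto_nhds_bot_mono' hbound fun n => (eLpNorm_congr_ae (.of_forall fun x => ?_)).trans_le
    (eLpNorm_inner_le hF.1 ((hG n).sub hV).1)
  exact (inner_sub_right ..).symm

end LpConvergence

section Gradient

variable {E : Type*} [NormedAddCommGroup E] [InnerProductSpace ℝ E] [CompleteSpace E]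
  {f g : E → ℝ} {x : E}

theorem norm_gradient_eq_norm_fderiv : ‖gradient f x‖ = ‖fderiv ℝ f x‖ := by
  rw [← toDual_gradient, LinearIsometryEquiv.norm_map]

theorem gradient_fun_sub (hf : DifferentiableAt ℝ f x) (hg : DifferentiableAt ℝ g x) :
    gradient (fun y => f y - g y) x = gradient f x - gradient g x := by
  rw [gradient, fderiv_fun_sub hf hg, map_sub, gradient, gradient]

theorem gradient_fun_add (hf : DifferentiableAt ℝ f x) (hg : DifferentiableAt ℝ g x) :
    gradient (fun y => f y + g y) x = gradient f x + gradient g x := by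
  rw [gradient, fderiv_fun_add hf hg, map_add, gradient, gradient]

theorem gradient_fun_const_smul (hf : DifferentiableAt ℝ f x) (c : ℝ) :
    gradient (fun y => c • f y) x = c • gradient f x := by
  rw [gradient, fderiv_fun_const_smul hf, map_smul, gradient]

theorem gradient_comp {ψ : ℝ → ℝ} (hψ : DifferentiableAt ℝ ψ (f x)) (hf : DifferentiableAt ℝ f x) :
    gradient (ψ ∘ f) x = deriv ψ (f x) • gradient f x := by
  rw [gradient, (hψ.hasDerivAt.comp_hasFDerivAt x hf.hasFDerivAt).fderiv, map_smul, gradient]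

end Gradient

section TestFunction

variable {E : Type*} [NormedAddCommGroup E] [InnerProductSpace ℝ E] {Ω : Opens E}

theorem differentiable_testFunction (φ : 𝓓(Ω, ℝ)) : Differentiable ℝ φ :=
  φ.contDiff.differentiable (by simp)

theorem testFunction_eq_zero_of_notMem (φ : 𝓓(Ω, ℝ)) {x : E} (hx : x ∉ Ω) : φ x = 0 :=
  image_eq_zero_of_notMem_tsupport fun h => hx (φ.tsupport_subset h)

/-- `ψ ∘ φ` as a test function, for `ψ` smooth with `ψ 0 = 0`: the nonlinear functions of a test
function that are again admissible in weak formulations. -/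
noncomputable def compTestFunction (ψ : ℝ → ℝ) (hψ : ContDiff ℝ (⊤ : ℕ∞) ψ) (h0 : ψ 0 = 0)
    (φ : 𝓓(Ω, ℝ)) : 𝓓(Ω, ℝ) :=
  ⟨ψ ∘ φ, hψ.comp φ.contDiff, φ.hasCompactSupport.comp_left h0,
    (tsupport_comp_subset h0 φ).trans φ.tsupport_subset⟩

@[simp]
theorem compTestFunction_apply {ψ : ℝ → ℝ} (hψ : ContDiff ℝ (⊤ : ℕ∞) ψ) (h0 : ψ 0 = 0)
    (φ : 𝓓(Ω, ℝ)) (x : E) : compTestFunction ψ hψ h0 φ x = ψ (φ x) := rfl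

/-- The derivative `∂ᵥφ` as a test function. -/
noncomputable def dirDerivTestFunction (φ : 𝓓(Ω, ℝ)) (v : E) : 𝓓(Ω, ℝ) :=
  ⟨fun x => fderiv ℝ φ x v,
    (φ.contDiff.fderiv_right (m := (⊤ : ℕ∞)) (by simp)).clm_apply contDiff_const,
    (φ.hasCompactSupport.fderiv (𝕜 := ℝ)).comp_left (g := fun L : E →L[ℝ] ℝ => L v) (by simp),
    ((tsupport_comp_subset (g := fun L : E →L[ℝ] ℝ => L v) (by simp) _).trans
      (tsupport_fderiv_subset ℝ)).trans φ.tsupport_subset⟩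

@[simp]
theorem dirDerivTestFunction_apply (φ : 𝓓(Ω, ℝ)) (v x : E) :
    dirDerivTestFunction φ v x = fderiv ℝ φ x v := rfl

section CompleteSpace

variable [CompleteSpace E]

theorem continuous_gradient_testFunction (φ : 𝓓(Ω, ℝ)) : Continuous (gradient φ) :=
  (InnerProductSpace.toDual ℝ E).symm.continuous.comp (φ.contDiff.continuous_fderiv (by simp))

theorem hasCompactSupport_gradient_testFunction (φ : 𝓓(Ω, ℝ)) :
    HasCompactSupport (gradient φ) :=
  (φ.hasCompactSupport.fderiv (𝕜 := ℝ)).comp_left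
    (g := (InnerProductSpace.toDual ℝ E).symm) (map_zero _)

theorem gradient_testFunction_eq_zero_of_notMem (φ : 𝓓(Ω, ℝ)) {x : E} (hx : x ∉ Ω) :
    gradient φ x = 0 := by
  have : fderiv ℝ φ x = 0 := image_eq_zero_of_notMem_tsupport fun h =>
    hx (φ.tsupport_subset (tsupport_fderiv_subset ℝ h))
  rw [gradient, this, map_zero]

theorem gradient_testFunction_sub (φ ψ : 𝓓(Ω, ℝ)) (x : E) :
    gradient (φ - ψ : 𝓓(Ω, ℝ)) x = gradient φ x - gradient ψ x :=
  gradient_fun_sub (differentiable_testFunction φ x) (differentiable_testFunction ψ x)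

theorem gradient_testFunction_add (φ ψ : 𝓓(Ω, ℝ)) (x : E) :
    gradient (φ + ψ : 𝓓(Ω, ℝ)) x = gradient φ x + gradient ψ x :=
  gradient_fun_add (differentiable_testFunction φ x) (differentiable_testFunction ψ x)

theorem gradient_testFunction_smul (c : ℝ) (φ : 𝓓(Ω, ℝ)) (x : E) :
    gradient (c • φ : 𝓓(Ω, ℝ)) x = c • gradient φ x :=
  gradient_fun_const_smul (differentiable_testFunction φ x) c

theorem gradient_compTestFunction {ψ : ℝ → ℝ} (hψ : ContDiff ℝ (⊤ : ℕ∞) ψ) (h0 : ψ 0 = 0)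
    (φ : 𝓓(Ω, ℝ)) (x : E) :
    gradient (compTestFunction ψ hψ h0 φ) x = deriv ψ (φ x) • gradient φ x :=
  gradient_comp (hψ.differentiable (by simp) _) (differentiable_testFunction φ x)

end CompleteSpace

variable [MeasurableSpace E] [BorelSpace E] {μ : Measure E}

theorem memLp_testFunction [IsFiniteMeasureOnCompacts μ] (φ : 𝓓(Ω, ℝ)) (p : ℝ≥0∞) :
    MemLp φ p μ :=
  φ.continuous.memLp_of_hasCompactSupport φ.hasCompactSupport

theorem memLp_gradient_testFunction [IsFiniteMeasureOnCompacts μ] [CompleteSpace E] (φ : 𝓓(Ω, ℝ))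
    (p : ℝ≥0∞) : MemLp (gradient φ) p μ :=
  (continuous_gradient_testFunction φ).memLp_of_hasCompactSupport
    (hasCompactSupport_gradient_testFunction φ)

theorem integrable_mul_testFunction {h : E → ℝ} (hh : LocallyIntegrableOn h Ω μ) (φ : 𝓓(Ω, ℝ)) :
    Integrable (fun x => h x * φ x) μ := by
  obtain ⟨M, hM⟩ := φ.hasCompactSupport.exists_bound_of_continuous φ.continuous
  have hint : IntegrableOn (fun x => h x * φ x) (tsupport φ) μ :=
    (hh.integrableOn_compact_subset φ.tsupport_subset φ.hasCompactSupport).mul_bdd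
      φ.continuous.aestronglyMeasurable (.of_forall hM)
  exact (integrableOn_iff_integrable_of_support_subset
    ((Function.support_mul_subset_right _ _).trans (subset_tsupport _))).1 hint

theorem integral_mul_inner_gradient_testFunction [FiniteDimensional ℝ E] [μ.IsAddHaarMeasure]
    (φ : 𝓓(Ω, ℝ)) {f : E → ℝ} {D : E → E} (hf : ∀ x ∈ Ω, HasGradientAt f (D x) x)
    (hD : ContinuousOn D Ω) (v : E) :
    ∫ x in (Ω : Set E), f x * inner ℝ (gradient φ x) v ∂μ =
      - ∫ x in (Ω : Set E), inner ℝ (D x) v * φ x ∂μ := by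
  have hΩ : MeasurableSet (Ω : Set E) := Ω.isOpen.measurableSet
  have hfc : LocallyIntegrableOn f Ω μ := (HasGradientAt.continuousOn hf).locallyIntegrableOn hΩ
  have hdf : LocallyIntegrableOn (fun x => fderiv ℝ f x v) Ω μ :=
    ((hD.inner continuousOn_const).congr
      fun x hx => (hf x hx).fderiv_apply).locallyIntegrableOn hΩ
  have parts := integral_mul_fderiv_eq_neg_fderiv_mul_of_integrable (μ := μ)
    (integrable_mul_testFunction hdf φ)
    (integrable_mul_testFunction hfc (dirDerivTestFunction φ v))
    (integrable_mul_testFunction hfc φ)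
    (fun x hx => (hf x (φ.tsupport_subset hx)).differentiableAt)
    (fun x _ => differentiable_testFunction φ x)
  rw [setIntegral_eq_integral_of_forall_compl_eq_zero fun x hx => by
      simp [gradient_testFunction_eq_zero_of_notMem φ hx],
    setIntegral_eq_integral_of_forall_compl_eq_zero fun x hx => by
      simp [testFunction_eq_zero_of_notMem φ hx]]
  simp only [inner_gradient_left, parts, neg_inj]
  refine integral_congr_ae (.of_forall fun x => ?_)
  by_cases hx : x ∈ Ω
  · simp [(hf x hx).fderiv_apply]
  · simp [testFunction_eq_zero_of_notMem φ hx]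

end TestFunction

section SobolevZero

variable {Ω : Opens Plane} {p : ℝ≥0∞} {u w : Plane → ℝ} {U W : Plane → Plane}

theorem isFiniteMeasure_volOn (hΩ : Bornology.IsBounded (Ω : Set Plane)) :
    IsFiniteMeasure (volOn Ω) :=
  ⟨by simpa using hΩ.measure_lt_top⟩

theorem MemW10.of_tendsto (hp : 1 ≤ p) (hu : MemLp u p (volOn Ω)) (hU : MemLp U p (volOn Ω))
    (φ : ℕ → 𝓓(Ω, ℝ))
    (hφ : Tendsto (fun n => eLpNorm (fun x => φ n x - u x) p (volOn Ω)) atTop (𝓝 0))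
    (hdφ : Tendsto (fun n => eLpNorm (fun x => gradient (φ n) x - U x) p (volOn Ω)) atTop
      (𝓝 0)) :
    MemW10 Ω p u U := by
  refine ⟨⟨hu, hU, locallyIntegrableOn_of_locallyIntegrable_restrict (hu.locallyIntegrable hp),
    locallyIntegrableOn_of_locallyIntegrable_restrict (hU.locallyIntegrable hp),
    fun η v => ?_⟩, φ, hφ, hdφ⟩
  have : p.conjExponent.HolderConjugate p := (ENNReal.HolderConjugate.conjExponent hp).symm
  have hlim : Tendsto (fun n => ∫ x in (Ω : Set Plane), φ n x * inner ℝ (gradient η x) v) atTop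
      (𝓝 (∫ x in (Ω : Set Plane), u x * inner ℝ (gradient η x) v)) :=
    tendsto_integral_inner (p := p.conjExponent) ((memLp_gradient_testFunction η _).inner_const v)
      (fun n => memLp_testFunction (φ n) p) hu hφ
  have hdlim := tendsto_integral_inner (p := p.conjExponent) (F := fun x => η x • v)
    ((η.continuous.smul continuous_const).memLp_of_hasCompactSupport
      η.hasCompactSupport.smul_right) (fun n => memLp_gradient_testFunction (φ n) p) hU hdφ
  simp only [real_inner_smul_left, ← real_inner_comm v, mul_comm (η _)] at hdlim
  refine tendsto_nhds_unique hlim (hdlim.neg.congr fun n => ?_)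
  exact (integral_mul_inner_gradient_testFunction η
    (fun x _ => (differentiable_testFunction (φ n) x).hasGradientAt)
    (continuous_gradient_testFunction (φ n)).continuousOn v).symm

theorem MemW10.of_tendsto_memW10 (hp : 1 ≤ p) (hu : MemLp u p (volOn Ω))
    (hU : MemLp U p (volOn Ω)) {v : ℕ → Plane → ℝ} {V : ℕ → Plane → Plane}
    (hvV : ∀ n, MemW10 Ω p (v n) (V n))
    (hv : Tendsto (fun n => eLpNorm (fun x => v n x - u x) p (volOn Ω)) atTop (𝓝 0))
    (hV : Tendsto (fun n => eLpNorm (fun x => V n x - U x) p (volOn Ω)) atTop (𝓝 0)) :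
    MemW10 Ω p u U := by
  have happrox (n : ℕ) : ∃ φ : 𝓓(Ω, ℝ),
      eLpNorm (fun x => φ x - v n x) p (volOn Ω) ≤ (n : ℝ≥0∞)⁻¹ ∧
      eLpNorm (fun x => gradient φ x - V n x) p (volOn Ω) ≤ (n : ℝ≥0∞)⁻¹ := by
    obtain ⟨-, φ, hφ, hdφ⟩ := hvV n
    have hn : (0 : ℝ≥0∞) < (n : ℝ≥0∞)⁻¹ := ENNReal.inv_pos.2 (ENNReal.natCast_ne_top n)
    obtain ⟨m, hm⟩ := ((hφ.eventually_le_const hn).and (hdφ.eventually_le_const hn)).exists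
    exact ⟨φ m, hm⟩
  choose φ hφ hdφ using happrox
  have hinv := ENNReal.tendsto_inv_nat_nhds_zero
  exact .of_tendsto hp hu hU φ
    (tendsto_eLpNorm_of_norm_le_add hp
      (fun n => ((memLp_testFunction (φ n) p).sub (hvV n).1.1).1)
      (fun n => ((hvV n).1.1.sub hu).1) (tendsto_nhds_bot_mono' hinv hφ) hv
      fun n => .of_forall fun x => norm_sub_le_norm_sub_add_norm_sub _ _ _)
    (tendsto_eLpNorm_of_norm_le_add hp
      (fun n => ((memLp_gradient_testFunction (φ n) p).sub (hvV n).1.2.1).1)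
      (fun n => ((hvV n).1.2.1.sub hU).1) (tendsto_nhds_bot_mono' hinv hdφ) hV
      fun n => .of_forall fun x => norm_sub_le_norm_sub_add_norm_sub _ _ _)

theorem MemW10.sub (hp : 1 ≤ p) (hu : MemW10 Ω p u U) (hw : MemW10 Ω p w W) :
    MemW10 Ω p (fun x => u x - w x) (fun x => U x - W x) := by
  obtain ⟨⟨hu, hU, -⟩, φ, hφ, hdφ⟩ := hu
  obtain ⟨⟨hw, hW, -⟩, η, hη, hdη⟩ := hw
  refine .of_tendsto hp (hu.sub hw) (hU.sub hW) (fun n => φ n - η n)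
    (tendsto_eLpNorm_of_norm_le_add hp (fun n => ((memLp_testFunction (φ n) p).sub hu).1)
      (fun n => ((memLp_testFunction (η n) p).sub hw).1) hφ hη fun n => .of_forall fun x => ?_)
    (tendsto_eLpNorm_of_norm_le_add hp (fun n => ((memLp_gradient_testFunction (φ n) p).sub hU).1)
      (fun n => ((memLp_gradient_testFunction (η n) p).sub hW).1) hdφ hdη
      fun n => .of_forall fun x => ?_)
  · simpa only [FunLike.coe_sub, Pi.sub_apply, sub_sub_sub_comm] using
      norm_sub_le (φ n x - u x) (η n x - w x)
  · simpa only [gradient_testFunction_sub, Pi.sub_apply, sub_sub_sub_comm] using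
      norm_sub_le (gradient (φ n) x - U x) (gradient (η n) x - W x)

theorem MemW10.exists_seq_tendsto_ae (hp : p ≠ 0) (hu : MemW10 Ω p u U) :
    ∃ φ : ℕ → 𝓓(Ω, ℝ), (∀ᵐ x ∂(volOn Ω), Tendsto (fun n => φ n x) atTop (𝓝 (u x))) ∧
      Tendsto (fun n => eLpNorm (fun x => φ n x - u x) p (volOn Ω)) atTop (𝓝 0) ∧
      Tendsto (fun n => eLpNorm (fun x => gradient (φ n) x - U x) p (volOn Ω)) atTop (𝓝 0) := by
  obtain ⟨⟨hu, -⟩, φ, hφ, hdφ⟩ := hu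
  obtain ⟨s, hs, hae⟩ := (tendstoInMeasure_of_tendsto_eLpNorm hp
    (fun n => (memLp_testFunction (φ n) p).1) hu.1 hφ).exists_seq_tendsto_ae
  exact ⟨φ ∘ s, hae, hφ.comp hs.tendsto_atTop, hdφ.comp hs.tendsto_atTop⟩

section ChainRule

variable {ψ : ℝ → ℝ} {M : ℝ}

theorem norm_sub_le_of_abs_deriv_le (hψ : Differentiable ℝ ψ) (hM : ∀ t, |deriv ψ t| ≤ M)
    (s t : ℝ) : ‖ψ s - ψ t‖ ≤ M * ‖s - t‖ :=
  Convex.norm_image_sub_le_of_norm_deriv_le (fun x _ => hψ x) (fun x _ => hM x) convex_univ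
    (mem_univ t) (mem_univ s)

theorem memLp_deriv_comp_smul {α E : Type*} [MeasurableSpace α] {μ : Measure α}
    [NormedAddCommGroup E] [NormedSpace ℝ E] {f : α → ℝ} {F : α → E}
    (hf : AEStronglyMeasurable f μ) (hF : MemLp F p μ) (hψ : ContDiff ℝ 1 ψ)
    (hM : ∀ t, |deriv ψ t| ≤ M) : MemLp (fun x => deriv ψ (f x) • F x) p μ :=
  hF.of_le_mul (c := M) (((hψ.continuous_deriv le_rfl).comp_aestronglyMeasurable hf).smul hF.1)
    (.of_forall fun x => by rw [norm_smul]; gcongr; exact hM _)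

theorem tendsto_eLpNorm_deriv_comp_smul {α E : Type*} [MeasurableSpace α] {μ : Measure α}
    [NormedAddCommGroup E] [NormedSpace ℝ E] {f : ℕ → α → ℝ} {F : ℕ → α → E} {g : α → ℝ}
    {G : α → E} (hp : 1 ≤ p) (hp_top : p ≠ ∞) (hf : ∀ n, AEStronglyMeasurable (f n) μ)
    (hg : AEStronglyMeasurable g μ) (hF : ∀ n, AEStronglyMeasurable (F n) μ) (hG : MemLp G p μ)
    (hfg : ∀ᵐ x ∂μ, Tendsto (fun n => f n x) atTop (𝓝 (g x)))
    (hFG : Tendsto (fun n => eLpNorm (fun x => F n x - G x) p μ) atTop (𝓝 0))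
    (hψ : ContDiff ℝ 1 ψ) (hM : ∀ t, |deriv ψ t| ≤ M) :
    Tendsto (fun n => eLpNorm (fun x => deriv ψ (f n x) • F n x - deriv ψ (g x) • G x) p μ)
      atTop (𝓝 0) := by
  have hψ' : Continuous (deriv ψ) := hψ.continuous_deriv le_rfl
  have hgm : AEStronglyMeasurable (fun x => deriv ψ (g x)) μ := hψ'.comp_aestronglyMeasurable hg
  have hfm (n : ℕ) : AEStronglyMeasurable (fun x => deriv ψ (f n x)) μ :=
    hψ'.comp_aestronglyMeasurable (hf n)
  have hcoeff : Tendsto (fun n => eLpNorm (fun x => (deriv ψ (f n x) - deriv ψ (g x)) • G x) p μ)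
      atTop (𝓝 0) := by
    refine tendsto_eLpNorm_of_dominated (zero_lt_one.trans_le hp).ne' hp_top
      (fun n => ((hfm n).sub hgm).smul hG.1) (hG.norm.const_mul (2 * M))
      (fun n => .of_forall fun x => ?_) ?_
    · rw [norm_smul, two_mul]
      gcongr
      exact (norm_sub_le _ _).trans (add_le_add (hM _) (hM _))
    · filter_upwards [hfg] with x hx
      have : Tendsto (fun n => deriv ψ (f n x) - deriv ψ (g x)) atTop (𝓝 0) := by
        simpa using ((hψ'.tendsto _).comp hx).sub_const (deriv ψ (g x))
      simpa using this.smul_const (G x)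
  have hfactor : Tendsto (fun n => eLpNorm (fun x => deriv ψ (f n x) • (F n x - G x)) p μ)
      atTop (𝓝 0) :=
    tendsto_eLpNorm_of_norm_le_mul hFG M fun n => .of_forall fun x => by
      rw [norm_smul]; gcongr; exact hM _
  refine tendsto_eLpNorm_of_norm_le_add hp (fun n => (hfm n).smul ((hF n).sub hG.1))
    (fun n => ((hfm n).sub hgm).smul hG.1) hfactor hcoeff fun n => .of_forall fun x => ?_
  rw [show deriv ψ (f n x) • F n x - deriv ψ (g x) • G x = deriv ψ (f n x) • (F n x - G x) +
    (deriv ψ (f n x) - deriv ψ (g x)) • G x by module]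
  exact norm_add_le _ _

theorem MemW10.comp (hp : 1 ≤ p) (hp_top : p ≠ ∞) (hu : MemW10 Ω p u U)
    (hψ : ContDiff ℝ (⊤ : ℕ∞) ψ) (h0 : ψ 0 = 0) (hM : ∀ t, |deriv ψ t| ≤ M) :
    MemW10 Ω p (fun x => ψ (u x)) (fun x => deriv ψ (u x) • U x) := by
  obtain ⟨φ, hae, hφ, hdφ⟩ := hu.exists_seq_tendsto_ae (zero_lt_one.trans_le hp).ne'
  obtain ⟨⟨hu, hU, -⟩, -⟩ := hu
  have hlip := norm_sub_le_of_abs_deriv_le (hψ.differentiable (by simp)) hM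
  refine .of_tendsto hp ?_ (memLp_deriv_comp_smul hu.1 hU (hψ.of_le (by simp)) hM)
    (fun n => compTestFunction ψ hψ h0 (φ n))
    (tendsto_eLpNorm_of_norm_le_mul hφ M fun n => .of_forall fun x => hlip _ _) ?_
  · exact hu.of_le_mul (hψ.continuous.comp_aestronglyMeasurable hu.1)
      (.of_forall fun x => by simpa [h0] using hlip (u x) 0)
  · simp only [gradient_compTestFunction]
    exact tendsto_eLpNorm_deriv_comp_smul hp hp_top (fun n => (memLp_testFunction (φ n) p).1) hu.1
      (fun n => (memLp_gradient_testFunction (φ n) p).1) hU hae hdφ (hψ.of_le (by simp)) hM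

end ChainRule

end SobolevZero

/-- `-div F = g` in `Ω` in the sense of distributions; for `F = ∇u` this is `-Δu = g`, stated
without derivatives of `F` so that `u` may be merely of class `W^{1,1}`. -/
def HasWeakNegDiv (Ω : Opens Plane) (F : Plane → Plane) (g : Plane → ℝ) : Prop :=
  ∀ φ : 𝓓(Ω, ℝ), ∫ x in (Ω : Set Plane), inner ℝ (F x) (gradient φ x) =
    ∫ x in (Ω : Set Plane), g x * φ x

section WeakNegDiv

variable {Ω : Opens Plane} {p q : ℝ≥0∞} {F F' U : Plane → Plane} {g g' u : Plane → ℝ}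

theorem HasWeakNegDiv.sub (hp : 1 ≤ p) (h : HasWeakNegDiv Ω F g) (h' : HasWeakNegDiv Ω F' g')
    (hF : MemLp F p (volOn Ω)) (hF' : MemLp F' p (volOn Ω)) (hg : Integrable g (volOn Ω))
    (hg' : Integrable g' (volOn Ω)) :
    HasWeakNegDiv Ω (fun x => F x - F' x) (fun x => g x - g' x) := by
  intro φ
  have := ENNReal.HolderConjugate.conjExponent hp
  have hF_int {H : Plane → Plane} (hH : MemLp H p (volOn Ω)) :
      Integrable (fun x => inner ℝ (H x) (gradient φ x)) (volOn Ω) :=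
    integrable_inner_of_memLp (q := p.conjExponent) hH (memLp_gradient_testFunction φ _)
  have hg_int {h : Plane → ℝ} (hh : Integrable h (volOn Ω)) :
      Integrable (fun x => h x * φ x) (volOn Ω) :=
    hh.mul_of_top_left (memLp_testFunction φ ∞)
  simp only [inner_sub_left, sub_mul]
  rw [integral_sub (hF_int hF) (hF_int hF'), integral_sub (hg_int hg) (hg_int hg'), h φ, h' φ]

variable [p.HolderConjugate q]

theorem HasWeakNegDiv.integral_inner (h : HasWeakNegDiv Ω F g) (hF : MemLp F p (volOn Ω))
    (hg : MemLp g p (volOn Ω)) (hu : MemW10 Ω q u U) :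
    ∫ x in (Ω : Set Plane), inner ℝ (F x) (U x) = ∫ x in (Ω : Set Plane), g x * u x := by
  obtain ⟨⟨hu, hU, -⟩, φ, hφ, hdφ⟩ := hu
  have hlim : Tendsto (fun n => ∫ x in (Ω : Set Plane), φ n x * g x) atTop
      (𝓝 (∫ x in (Ω : Set Plane), u x * g x)) :=
    tendsto_integral_inner hg (fun n => memLp_testFunction (φ n) q) hu hφ
  have hdlim := tendsto_integral_inner hF (fun n => memLp_gradient_testFunction (φ n) q) hU hdφ
  simp only [h _] at hdlim
  simp only [mul_comm _ (g _)] at hlim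
  exact tendsto_nhds_unique hdlim hlim

theorem HasWeakNegDiv.integral_inner_comp (h : HasWeakNegDiv Ω F g) (hF : MemLp F p (volOn Ω))
    (hg : Integrable g (volOn Ω)) (hq : q ≠ ∞) (hu : MemW10 Ω q u U) {ψ : ℝ → ℝ}
    (hψ : ContDiff ℝ (⊤ : ℕ∞) ψ) (h0 : ψ 0 = 0) {M B : ℝ} (hM : ∀ t, |deriv ψ t| ≤ M)
    (hB : ∀ t, |ψ t| ≤ B) :
    ∫ x in (Ω : Set Plane), inner ℝ (F x) (deriv ψ (u x) • U x) =
      ∫ x in (Ω : Set Plane), g x * ψ (u x) := by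
  have hq1 : 1 ≤ q := ENNReal.HolderConjugate.one_le q p
  obtain ⟨φ, hae, -, hdφ⟩ := hu.exists_seq_tendsto_ae (zero_lt_one.trans_le hq1).ne'
  obtain ⟨⟨hu, hU, -⟩, -⟩ := hu
  have hψ1 : ContDiff ℝ 1 ψ := hψ.of_le (by simp)
  have hdlim := tendsto_integral_inner hF
    (fun n => memLp_deriv_comp_smul (memLp_testFunction (φ n) q).1
      (memLp_gradient_testFunction (φ n) q) hψ1 hM)
    (memLp_deriv_comp_smul hu.1 hU hψ1 hM)
    (tendsto_eLpNorm_deriv_comp_smul hq1 hq (fun n => (memLp_testFunction (φ n) q).1) hu.1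
      (fun n => (memLp_gradient_testFunction (φ n) q).1) hU hae hdφ hψ1 hM)
  simp only [← gradient_compTestFunction hψ h0, h _, compTestFunction_apply] at hdlim
  refine tendsto_nhds_unique hdlim (tendsto_integral_of_dominated_convergence
    (fun x => ‖g x‖ * B)
    (fun n => hg.1.mul (hψ.continuous.comp (φ n).continuous).aestronglyMeasurable)
    (hg.norm.mul_const _) (fun n => .of_forall fun x => ?_) ?_)
  · rw [norm_mul]; gcongr; exact hB _
  · filter_upwards [hae] with x hx
    exact ((hψ.continuous.tendsto _).comp hx).const_mul _

end WeakNegDiv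

section Sobolev

variable {Ω : Opens Plane}

theorem exists_eLpNorm_testFunction_le_of_lt_two (hΩ : Bornology.IsBounded (Ω : Set Plane))
    {p q : ℝ≥0} (hp : 1 ≤ p) (hp2 : p < 2) (hpq : (p : ℝ)⁻¹ - 2⁻¹ ≤ (q : ℝ)⁻¹) :
    ∃ C : ℝ≥0, ∀ φ : 𝓓(Ω, ℝ),
      eLpNorm φ q (volOn Ω) ≤ C * eLpNorm (gradient φ) p (volOn Ω) := by
  refine ⟨eLpNormLESNormFDerivOfLeConst ℝ (volume : Measure Plane) Ω p q, fun φ => ?_⟩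
  have hsobolev := eLpNorm_le_eLpNorm_fderiv_of_le (volume : Measure Plane) (u := φ) (s := Ω)
    (φ.contDiff.of_le (by simp)) ((subset_tsupport _).trans φ.tsupport_subset) hp (q := q)
    (by simpa using hp2) (by simpa using hpq) hΩ
  have hsupp : Function.support (gradient φ) ⊆ Ω := fun x hx => by
    by_contra hxΩ
    exact hx (gradient_testFunction_eq_zero_of_notMem φ hxΩ)
  have hnorm : eLpNorm (gradient φ) p volume = eLpNorm (fderiv ℝ φ) p volume :=
    eLpNorm_congr_norm_ae (.of_forall fun x => norm_gradient_eq_norm_fderiv)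
  rw [volOn, eLpNorm_restrict_eq_of_support_subset hsupp, hnorm]
  exact (eLpNorm_mono_measure _ Measure.restrict_le_self).trans hsobolev

theorem exists_eLpNorm_testFunction_le_eLpNorm_gradient_two
    (hΩ : Bornology.IsBounded (Ω : Set Plane)) {m : ℝ≥0} (hm : 2 ≤ m) :
    ∃ C : ℝ≥0, ∀ φ : 𝓓(Ω, ℝ),
      eLpNorm φ m (volOn Ω) ≤ C * eLpNorm (gradient φ) 2 (volOn Ω) := by
  have := isFiniteMeasure_volOn hΩ
  set p : ℝ≥0 := 2 * m / (m + 2) with hp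
  have hp1 : 1 ≤ p := by
    rw [hp, ← NNReal.coe_le_coe]; push_cast; rw [le_div_iff₀ (by positivity)]
    have : (2 : ℝ) ≤ m := mod_cast hm
    linarith
  have hp2 : p < 2 := by
    rw [hp, ← NNReal.coe_lt_coe]; push_cast; rw [div_lt_iff₀ (by positivity)]; linarith
  have hpm : (p : ℝ)⁻¹ - 2⁻¹ ≤ (m : ℝ)⁻¹ := by
    have : (m : ℝ) ≠ 0 := by positivity
    rw [hp]; push_cast; field_simp; linarith
  obtain ⟨C, hC⟩ := exists_eLpNorm_testFunction_le_of_lt_two hΩ hp1 hp2 hpm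
  obtain ⟨c, hc⟩ : ∃ c : ℝ≥0, volOn Ω univ ^ (1 / (p : ℝ≥0∞).toReal - 1 / (2 : ℝ≥0∞).toReal) = c :=
    ⟨_, (ENNReal.coe_toNNReal (ENNReal.rpow_ne_top_of_nonneg (sub_nonneg.2
      (one_div_le_one_div_of_le (by simpa using zero_lt_one.trans_le hp1)
        (mod_cast hp2.le))) (measure_ne_top _ _))).symm⟩
  refine ⟨C * c, fun φ => (hC φ).trans ?_⟩
  rw [ENNReal.coe_mul, mul_assoc, mul_comm (c : ℝ≥0∞), ← hc]
  gcongr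
  exact eLpNorm_le_eLpNorm_mul_rpow_measure_univ (mod_cast hp2.le)
    (memLp_gradient_testFunction φ 2).1

theorem MemW10.eLpNorm_map_le {F : Type*} [NormedAddCommGroup F] {p m : ℝ≥0∞} (hp : 1 ≤ p)
    {C : ℝ≥0} {T : (Plane → ℝ) → Plane → F} {u : Plane → ℝ} {U : Plane → Plane}
    (hT_meas : ∀ φ : 𝓓(Ω, ℝ), AEStronglyMeasurable (T φ) (volOn Ω))
    (hT_le : ∀ φ : 𝓓(Ω, ℝ), eLpNorm (T φ) m (volOn Ω) ≤ C * eLpNorm (gradient φ) p (volOn Ω))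
    (hT_lim : ∀ φ : ℕ → 𝓓(Ω, ℝ), (∀ᵐ x ∂(volOn Ω), Tendsto (fun n => φ n x) atTop (𝓝 (u x))) →
      Tendsto (fun n => eLpNorm (fun x => φ n x - u x) p (volOn Ω)) atTop (𝓝 0) →
      ∀ᵐ x ∂(volOn Ω), Tendsto (fun n => T (φ n) x) atTop (𝓝 (T u x)))
    (hu : MemW10 Ω p u U) : eLpNorm (T u) m (volOn Ω) ≤ C * eLpNorm U p (volOn Ω) := by
  obtain ⟨φ, hae, hφ, hdφ⟩ := hu.exists_seq_tendsto_ae (zero_lt_one.trans_le hp).ne'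
  have hU : MemLp U p (volOn Ω) := hu.1.2.1
  have hlim : Tendsto (fun n => C * (eLpNorm (fun x => gradient (φ n) x - U x) p (volOn Ω) +
      eLpNorm U p (volOn Ω))) atTop (𝓝 (C * eLpNorm U p (volOn Ω))) := by
    simpa using ENNReal.Tendsto.const_mul (a := C) (hdφ.add_const (eLpNorm U p (volOn Ω)))
      (.inr ENNReal.coe_ne_top)
  refine (Lp.eLpNorm_lim_le_liminf_eLpNorm (fun n => hT_meas (φ n)) _
    (hT_lim φ hae hφ)).trans ?_
  rw [← hlim.liminf_eq]
  refine liminf_le_liminf (.of_forall fun n => (hT_le _).trans ?_)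
  gcongr
  simpa [Pi.sub_def, Pi.add_def] using
    eLpNorm_add_le ((memLp_gradient_testFunction (φ n) p).sub hU).1 hU.1 hp

theorem MemW10.eLpNorm_le {p m : ℝ≥0∞} (hp : 1 ≤ p) {C : ℝ≥0}
    (hC : ∀ φ : 𝓓(Ω, ℝ), eLpNorm φ m (volOn Ω) ≤ C * eLpNorm (gradient φ) p (volOn Ω))
    {u : Plane → ℝ} {U : Plane → Plane} (hu : MemW10 Ω p u U) :
    eLpNorm u m (volOn Ω) ≤ C * eLpNorm U p (volOn Ω) :=
  hu.eLpNorm_map_le hp (T := id) (fun φ => (memLp_testFunction φ p).1) hC fun _ hae _ => hae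

end Sobolev

section EnergyEstimate

variable {Ω : Opens Plane} {u g : Plane → ℝ} {U : Plane → Plane}

theorem sq_eLpNorm_two {α E : Type*} [MeasurableSpace α] {μ : Measure α} [NormedAddCommGroup E]
    (f : α → E) : eLpNorm f 2 μ ^ 2 = ∫⁻ x, ‖f x‖ₑ ^ 2 ∂μ := by
  simpa using eLpNorm_nnreal_pow_eq_lintegral (μ := μ) (f := f) (p := 2) (by simp)

theorem HasWeakNegDiv.sq_eLpNorm_smul_le (h : HasWeakNegDiv Ω U g) (hg : Integrable g (volOn Ω))
    (hu : MemW10 Ω 2 u U) {ψ χ : ℝ → ℝ} (hψ : ContDiff ℝ (⊤ : ℕ∞) ψ) (h0 : ψ 0 = 0) {M B : ℝ}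
    (hM : ∀ t, |deriv ψ t| ≤ M) (hB : ∀ t, |ψ t| ≤ B) (hχ : ∀ t, χ t ^ 2 ≤ deriv ψ t) :
    eLpNorm (fun x => χ (u x) • U x) 2 (volOn Ω) ^ 2 ≤
      ENNReal.ofReal B * eLpNorm g 1 (volOn Ω) := by
  have hU : MemLp U 2 (volOn Ω) := hu.1.2.1
  have hint : Integrable (fun x => inner ℝ (U x) (deriv ψ (u x) • U x)) (volOn Ω) :=
    integrable_inner_of_memLp hU
      (memLp_deriv_comp_smul hu.1.1.1 hU (hψ.of_le (by simp)) hM)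
  have hpt (x : Plane) : ‖χ (u x) • U x‖ ^ 2 ≤ inner ℝ (U x) (deriv ψ (u x) • U x) := by
    rw [real_inner_smul_right, real_inner_self_eq_norm_sq, norm_smul, mul_pow, Real.norm_eq_abs,
      sq_abs]
    gcongr
    exact hχ _
  calc eLpNorm (fun x => χ (u x) • U x) 2 (volOn Ω) ^ 2
      = ∫⁻ x in (Ω : Set Plane), ENNReal.ofReal (‖χ (u x) • U x‖ ^ 2) := by
        simp only [sq_eLpNorm_two, ENNReal.ofReal_pow (norm_nonneg _), ofReal_norm]
    _ ≤ ∫⁻ x in (Ω : Set Plane), ENNReal.ofReal (inner ℝ (U x) (deriv ψ (u x) • U x)) :=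
        lintegral_mono fun x => ENNReal.ofReal_le_ofReal (hpt x)
    _ = ENNReal.ofReal (∫ x in (Ω : Set Plane), g x * ψ (u x)) := by
        rw [← h.integral_inner_comp hU hg (by simp) hu hψ h0 hM hB,
          ofReal_integral_eq_lintegral_ofReal hint
            (.of_forall fun x => (sq_nonneg _).trans (hpt x))]
    _ ≤ ENNReal.ofReal (B * ∫ x in (Ω : Set Plane), ‖g x‖) := by
        rw [← integral_const_mul]
        refine ENNReal.ofReal_le_ofReal ((Real.le_norm_self _).trans
          (norm_integral_le_of_norm_le (hg.norm.const_mul B) (.of_forall fun x => ?_)))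
        rw [norm_mul, mul_comm]
        gcongr
        exact hB _
    _ = ENNReal.ofReal B * eLpNorm g 1 (volOn Ω) := by
        rw [ENNReal.ofReal_mul ((abs_nonneg _).trans (hB 0)), eLpNorm_one_eq_lintegral_enorm,
          ofReal_integral_norm_eq_lintegral_enorm hg]

theorem HasWeakNegDiv.eLpNorm_le (h : HasWeakNegDiv Ω U g) (hg : Integrable g (volOn Ω))
    (hu : MemW10 Ω 2 u U) {ψ χ : ℝ → ℝ} (hψ : ContDiff ℝ (⊤ : ℕ∞) ψ) (h0 : ψ 0 = 0) {M B : ℝ}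
    (hM : ∀ t, |deriv ψ t| ≤ M) (hB : ∀ t, |ψ t| ≤ B) (hχc : Continuous χ)
    (hχ0 : ∀ t, χ t ≠ 0) (hχ : ∀ t, χ t ^ 2 ≤ deriv ψ t) (r q : ℝ≥0∞) [r.HolderTriple 2 q] :
    eLpNorm U q (volOn Ω) ≤ eLpNorm (fun x => (χ (u x))⁻¹) r (volOn Ω) *
      (ENNReal.ofReal B * eLpNorm g 1 (volOn Ω)) ^ (2⁻¹ : ℝ) := by
  have hsplit : U = (fun x => (χ (u x))⁻¹) • fun x => χ (u x) • U x := by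
    ext1 x
    exact (inv_smul_smul₀ (hχ0 _) _).symm
  nth_rw 1 [hsplit]
  refine (eLpNorm_smul_le_mul_eLpNorm (p := r) (q := 2)
    ((hχc.comp_aestronglyMeasurable hu.1.1.1).smul hu.1.2.1.1)
    ((hχc.inv₀ hχ0).comp_aestronglyMeasurable hu.1.1.1)).trans (mul_le_mul_right ?_ _)
  rw [ENNReal.le_rpow_inv_iff two_pos]
  exact_mod_cast h.sq_eLpNorm_smul_le hg hu hψ h0 hM hB hχ

end EnergyEstimate

section BracketPrimitive

/-- The primitive `∫₀ᵗ (1 + s²)⁻ᵃ ds` of a power of the Japanese bracket: bounded for `a > 1/2`,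
and growing like `t ^ (1 - 2 * a)` for `a < 1/2`. -/
noncomputable def bracketPrimitive (a t : ℝ) : ℝ := ∫ s in (0 : ℝ)..t, (1 + s ^ 2) ^ (-a)

theorem contDiff_one_add_sq_rpow (a : ℝ) : ContDiff ℝ (⊤ : ℕ∞) fun t : ℝ => (1 + t ^ 2) ^ a :=
  ContDiff.rpow_const_of_ne (by fun_prop) fun t => by positivity

@[simp]
theorem bracketPrimitive_zero (a : ℝ) : bracketPrimitive a 0 = 0 :=
  intervalIntegral.integral_same

theorem deriv_bracketPrimitive (a : ℝ) :
    deriv (bracketPrimitive a) = fun t => (1 + t ^ 2) ^ (-a) :=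
  funext fun _ => ((contDiff_one_add_sq_rpow (-a)).continuous.deriv_integral ..)

theorem contDiff_bracketPrimitive (a : ℝ) : ContDiff ℝ (⊤ : ℕ∞) (bracketPrimitive a) := by
  rw [contDiff_infty_iff_deriv, deriv_bracketPrimitive]
  exact ⟨fun t => ((contDiff_one_add_sq_rpow (-a)).continuous.integral_hasStrictDerivAt 0
    t).hasDerivAt.differentiableAt, contDiff_one_add_sq_rpow _⟩

theorem abs_deriv_bracketPrimitive_le_one {a : ℝ} (ha : 0 ≤ a) (t : ℝ) :
    |deriv (bracketPrimitive a) t| ≤ 1 := by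
  rw [deriv_bracketPrimitive, abs_of_nonneg (by positivity)]
  exact Real.rpow_le_one_of_one_le_of_nonpos (by nlinarith) (by linarith)

theorem exists_abs_bracketPrimitive_le {a : ℝ} (ha : 1 / 2 < a) :
    ∃ B, ∀ t, |bracketPrimitive a t| ≤ B := by
  have hint : Integrable fun s : ℝ => (1 + s ^ 2) ^ (-a) := by
    have hdim : (Module.finrank ℝ ℝ : ℝ) < 2 * a := by
      rw [Module.finrank_self, Nat.cast_one]
      linarith
    simpa [neg_div] using integrable_rpow_neg_one_add_norm_sq (μ := volume) hdim
  refine ⟨∫ s : ℝ, ‖(1 + s ^ 2) ^ (-a)‖, fun t => ?_⟩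
  exact intervalIntegral.norm_integral_le_integral_norm_uIoc.trans
    (setIntegral_le_integral hint.norm (.of_forall fun _ => norm_nonneg _))

theorem bracketPrimitive_neg (a t : ℝ) : bracketPrimitive a (-t) = -bracketPrimitive a t := by
  have := intervalIntegral.integral_comp_neg (a := 0) (b := t) fun s : ℝ => (1 + s ^ 2) ^ (-a)
  rw [bracketPrimitive, intervalIntegral.integral_symm, bracketPrimitive]
  simpa using this.symm

theorem abs_mul_rpow_le_abs_bracketPrimitive {a : ℝ} (ha : 0 ≤ a) (t : ℝ) :
    |t * (1 + t ^ 2) ^ (-a)| ≤ |bracketPrimitive a t| := by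
  wlog ht : 0 ≤ t generalizing t
  · simpa [bracketPrimitive_neg] using this (-t) (by linarith)
  rw [abs_of_nonneg (by positivity)]
  refine le_trans ?_ (le_abs_self _)
  calc t * (1 + t ^ 2) ^ (-a) = ∫ _ in (0 : ℝ)..t, (1 + t ^ 2) ^ (-a) := by simp
    _ ≤ bracketPrimitive a t := by
      refine intervalIntegral.integral_mono_on ht intervalIntegrable_const
        ((contDiff_one_add_sq_rpow (-a)).continuous.intervalIntegrable ..) fun s hs => ?_
      have : s ^ 2 ≤ t ^ 2 := pow_le_pow_left₀ hs.1 hs.2 2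
      exact Real.rpow_le_rpow_of_nonpos (by positivity) (by linarith) (by linarith)

theorem one_add_sq_rpow_le_one_add_sq_bracketPrimitive {a : ℝ} (ha : 0 ≤ a) (t : ℝ) :
    (1 + t ^ 2) ^ (1 - 2 * a) ≤ 1 + bracketPrimitive a t ^ 2 := by
  have hpos : 0 < 1 + t ^ 2 := by positivity
  have hle : (1 + t ^ 2) ^ (-(2 * a)) ≤ 1 :=
    Real.rpow_le_one_of_one_le_of_nonpos (by nlinarith) (by linarith)
  calc (1 + t ^ 2) ^ (1 - 2 * a)
      = (1 + t ^ 2) ^ (-(2 * a)) + (t * (1 + t ^ 2) ^ (-a)) ^ 2 := by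
        rw [sub_eq_add_neg, Real.rpow_add hpos, Real.rpow_one, mul_pow,
          ← Real.rpow_mul_natCast hpos.le]
        push_cast
        ring_nf
    _ ≤ 1 + bracketPrimitive a t ^ 2 :=
        add_le_add hle (sq_le_sq.2 (abs_mul_rpow_le_abs_bracketPrimitive ha t))

end BracketPrimitive

section GradientBound

theorem exists_holderTriple_two {q : ℝ≥0∞} (hq1 : 1 ≤ q) (hq2 : q < 2) :
    ∃ r : ℝ≥0, 2 ≤ r ∧ (r : ℝ≥0∞).HolderTriple 2 q := by
  have hqi : (2 : ℝ≥0∞)⁻¹ < q⁻¹ := ENNReal.inv_lt_inv.2 hq2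
  lift (q⁻¹ - 2⁻¹)⁻¹ to ℝ≥0 using ENNReal.inv_ne_top.2 (tsub_pos_of_lt hqi).ne' with r hr
  refine ⟨r, ?_, ⟨by rw [hr, inv_inv, tsub_add_cancel_of_le hqi.le]⟩⟩
  rw [← ENNReal.coe_le_coe, hr, ENNReal.coe_ofNat, ENNReal.le_inv_iff_le_inv, tsub_le_iff_right,
    ENNReal.inv_two_add_inv_two]
  exact ENNReal.inv_le_one.2 hq1

theorem one_add_sq_rpow_le_two_add_bracketPrimitive (t : ℝ) :
    (1 + t ^ 2) ^ (3 / 8 : ℝ) ≤ 2 + 2 * bracketPrimitive (3 / 8) t ^ 4 := by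
  have hquarter := one_add_sq_rpow_le_one_add_sq_bracketPrimitive (a := 3 / 8) (by norm_num) t
  calc (1 + t ^ 2) ^ (3 / 8 : ℝ) ≤ (1 + t ^ 2) ^ ((1 - 2 * (3 / 8)) * (2 : ℕ) : ℝ) :=
        Real.rpow_le_rpow_of_exponent_le (by nlinarith) (by norm_num)
    _ = ((1 + t ^ 2) ^ (1 - 2 * (3 / 8) : ℝ)) ^ 2 := Real.rpow_mul_natCast (by positivity) _ _
    _ ≤ (1 + bracketPrimitive (3 / 8) t ^ 2) ^ 2 := by gcongr
    _ ≤ 2 + 2 * bracketPrimitive (3 / 8) t ^ 4 := by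
        nlinarith [sq_nonneg (bracketPrimitive (3 / 8) t ^ 2 - 1)]

theorem eLpNorm_one_add_sq_rpow_le {α : Type*} [MeasurableSpace α] {μ : Measure α} {f : α → ℝ}
    (hf : AEStronglyMeasurable f μ) {r : ℝ≥0∞} (hr : 1 ≤ r) :
    eLpNorm (fun x => (1 + f x ^ 2) ^ (3 / 8 : ℝ)) r μ ≤ eLpNorm (fun _ => (2 : ℝ)) r μ +
      2 * eLpNorm (fun x => bracketPrimitive (3 / 8) (f x)) (r * 4) μ ^ 4 := by
  set v : α → ℝ := fun x => bracketPrimitive (3 / 8) (f x)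
  have hv : AEStronglyMeasurable v μ :=
    (contDiff_bracketPrimitive _).continuous.comp_aestronglyMeasurable hf
  calc eLpNorm (fun x => (1 + f x ^ 2) ^ (3 / 8 : ℝ)) r μ
      ≤ eLpNorm ((fun _ => (2 : ℝ)) + (2 : ℝ) • fun x => v x ^ 4) r μ := by
        refine eLpNorm_mono_real fun x => ?_
        rw [Real.norm_of_nonneg (by positivity)]
        exact one_add_sq_rpow_le_two_add_bracketPrimitive _
    _ ≤ eLpNorm (fun _ => (2 : ℝ)) r μ + eLpNorm ((2 : ℝ) • fun x => v x ^ 4) r μ :=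
        eLpNorm_add_le aestronglyMeasurable_const ((hv.pow 4).const_smul _) hr
    _ = eLpNorm (fun _ => (2 : ℝ)) r μ + 2 * eLpNorm v (r * 4) μ ^ 4 := by
        have hpow := eLpNorm_norm_rpow v (p := r) (μ := μ) (q := 4) (by norm_num)
        have hnorm : eLpNorm (fun x => v x ^ 4) r μ = eLpNorm (fun x => ‖v x‖ ^ (4 : ℝ)) r μ :=
          eLpNorm_congr_norm_ae (.of_forall fun x => by norm_cast; simp)
        rw [eLpNorm_const_smul, hnorm, hpow, ENNReal.ofReal_ofNat, ENNReal.rpow_ofNat,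
          Real.enorm_of_nonneg zero_le_two, ENNReal.ofReal_ofNat]

variable {Ω : Opens Plane}

theorem MemW10.exists_eLpNorm_one_add_sq_rpow_le (hΩ : Bornology.IsBounded (Ω : Set Plane))
    {r : ℝ≥0} (hr : 2 ≤ r) (N : ℝ≥0) : ∃ K : ℝ≥0, ∀ (u : Plane → ℝ) (U : Plane → Plane),
      MemW10 Ω 2 u U →
      eLpNorm (fun x => deriv (bracketPrimitive (3 / 8)) (u x) • U x) 2 (volOn Ω) ≤ N →
      eLpNorm (fun x => (1 + u x ^ 2) ^ (3 / 8 : ℝ)) r (volOn Ω) ≤ K := by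
  have := isFiniteMeasure_volOn hΩ
  obtain ⟨S, hS⟩ := exists_eLpNorm_testFunction_le_eLpNorm_gradient_two hΩ (m := r * 4)
    (hr.trans (le_mul_of_one_le_right zero_le (by norm_num)))
  obtain ⟨c, hc⟩ : ∃ c : ℝ≥0, eLpNorm (fun _ : Plane => (2 : ℝ)) r (volOn Ω) = c :=
    ⟨_, (ENNReal.coe_toNNReal (memLp_const _).2.ne).symm⟩
  refine ⟨c + 2 * (S * N) ^ 4, fun u U hu hN => ?_⟩
  have hv : MemW10 Ω 2 (fun x => bracketPrimitive (3 / 8) (u x)) _ :=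
    hu.comp one_le_two (by simp) (contDiff_bracketPrimitive _) (bracketPrimitive_zero _)
      (abs_deriv_bracketPrimitive_le_one (by norm_num))
  have hvS : eLpNorm (fun x => bracketPrimitive (3 / 8) (u x)) (r * 4) (volOn Ω) ≤ S * N :=
    (hv.eLpNorm_le one_le_two (m := r * 4) (by exact_mod_cast hS)).trans (by gcongr)
  refine (eLpNorm_one_add_sq_rpow_le hu.1.1.1 (mod_cast one_le_two.trans hr)).trans ?_
  push_cast
  rw [hc]
  gcongr

theorem exists_eLpNorm_le_of_hasWeakNegDiv (hΩ : Bornology.IsBounded (Ω : Set Plane)) {q : ℝ≥0∞}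
    (hq1 : 1 ≤ q) (hq2 : q < 2) (C : ℝ≥0) : ∃ K : ℝ≥0, ∀ (u g : Plane → ℝ) (U : Plane → Plane),
      MemW10 Ω 2 u U → HasWeakNegDiv Ω U g → Integrable g (volOn Ω) →
      eLpNorm g 1 (volOn Ω) ≤ C → eLpNorm U q (volOn Ω) ≤ K := by
  obtain ⟨r, hr2, _⟩ := exists_holderTriple_two hq1 hq2
  obtain ⟨B, hB⟩ := exists_abs_bracketPrimitive_le (a := 3 / 4) (by norm_num)
  obtain ⟨N, hN⟩ : ∃ N : ℝ≥0, (ENNReal.ofReal B * C) ^ (2⁻¹ : ℝ) = N :=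
    ⟨_, (ENNReal.coe_toNNReal (ENNReal.rpow_ne_top_of_nonneg (by norm_num)
      (ENNReal.mul_ne_top ENNReal.ofReal_ne_top ENNReal.coe_ne_top))).symm⟩
  obtain ⟨W, hW⟩ := MemW10.exists_eLpNorm_one_add_sq_rpow_le hΩ hr2 N
  refine ⟨W * N, fun u g U hu hdiv hg hgC => ?_⟩
  have hχ (t : ℝ) :
      deriv (bracketPrimitive (3 / 8)) t ^ 2 ≤ deriv (bracketPrimitive (3 / 4)) t := by
    rw [deriv_bracketPrimitive, deriv_bracketPrimitive, ← Real.rpow_mul_natCast (by positivity)]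
    norm_num
  have hψ1 := abs_deriv_bracketPrimitive_le_one (a := 3 / 4) (by norm_num)
  have hdv : eLpNorm (fun x => deriv (bracketPrimitive (3 / 8)) (u x) • U x) 2 (volOn Ω) ≤ N := by
    rw [← hN, ENNReal.le_rpow_inv_iff two_pos, ENNReal.rpow_ofNat]
    exact (hdiv.sq_eLpNorm_smul_le hg hu (contDiff_bracketPrimitive _)
      (bracketPrimitive_zero _) hψ1 hB hχ).trans (by gcongr)
  have hweight : eLpNorm (fun x => (deriv (bracketPrimitive (3 / 8)) (u x))⁻¹) r (volOn Ω) ≤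
      W := by
    simp only [deriv_bracketPrimitive, Real.rpow_neg (add_nonneg zero_le_one (sq_nonneg _)),
      inv_inv]
    exact hW u U hu hdv
  have hχc : Continuous (deriv (bracketPrimitive (3 / 8))) :=
    deriv_bracketPrimitive (3 / 8) ▸ (contDiff_one_add_sq_rpow _).continuous
  have hχ0 (t : ℝ) : deriv (bracketPrimitive (3 / 8)) t ≠ 0 := by
    rw [deriv_bracketPrimitive]
    positivity
  refine (hdiv.eLpNorm_le hg hu (contDiff_bracketPrimitive _) (bracketPrimitive_zero _) hψ1 hB
    hχc hχ0 hχ r q).trans ?_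
  push_cast
  rw [← hN]
  gcongr

end GradientBound

section Mollification

variable {E : Type*} [NormedAddCommGroup E] [InnerProductSpace ℝ E] [FiniteDimensional ℝ E]
  [MeasurableSpace E] [BorelSpace E] {Ω : Opens E}

theorem tsupport_normed_convolution_subset_cthickening (μ : Measure E) [IsLocallyFiniteMeasure μ]
    [μ.IsOpenPosMeasure] (ρ : ContDiffBump (0 : E)) (v : E → ℝ) :
    tsupport (convolution (ρ.normed μ) v (ContinuousLinearMap.lsmul ℝ ℝ) μ) ⊆
      Metric.cthickening ρ.rOut (tsupport v) := by
  refine closure_minimal ((support_convolution_subset _).trans ?_) Metric.isClosed_cthickening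
  rw [ρ.support_normed_eq]
  rintro _ ⟨a, ha, b, hb, rfl⟩
  refine Metric.mem_cthickening_of_dist_le _ b _ _ (subset_tsupport _ hb) ?_
  simpa using (Metric.mem_ball.1 ha).le

theorem exists_testFunction_near {v : E → ℝ} (hv : ContDiff ℝ 1 v) (hc : HasCompactSupport v)
    (hs : tsupport v ⊆ Ω) {ε : ℝ} (hε : 0 < ε) :
    ∃ φ : 𝓓(Ω, ℝ), ∀ x, ‖φ x - v x‖ ≤ ε ∧ ‖gradient φ x - gradient v x‖ ≤ ε := by
  have hfc : Continuous (fderiv ℝ v) := hv.continuous_fderiv (by simp)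
  obtain ⟨δ₁, hδ₁0, hδ₁⟩ := Metric.uniformContinuous_iff.1
    (hc.uniformContinuous_of_continuous hv.continuous) ε hε
  obtain ⟨δ₂, hδ₂0, hδ₂⟩ := Metric.uniformContinuous_iff.1
    ((hc.fderiv (𝕜 := ℝ)).uniformContinuous_of_continuous hfc) ε hε
  obtain ⟨δ₃, hδ₃0, hδ₃⟩ := hc.isCompact.exists_cthickening_subset_open Ω.isOpen hs
  obtain ⟨δ, hδ0, hδ⟩ := exists_between (lt_min hδ₁0 (lt_min hδ₂0 hδ₃0))
  simp only [lt_min_iff] at hδ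
  let ρ : ContDiffBump (0 : E) := ⟨δ / 2, δ, half_pos hδ0, half_lt_self hδ0⟩
  let φ : 𝓓(Ω, ℝ) :=
    ⟨convolution (ρ.normed volume) v (ContinuousLinearMap.lsmul ℝ ℝ) volume,
      ρ.hasCompactSupport_normed.contDiff_convolution_left _ ρ.contDiff_normed
        hv.continuous.locallyIntegrable,
      ρ.hasCompactSupport_normed.convolution _ hc,
      (tsupport_normed_convolution_subset_cthickening volume ρ v).trans
        ((Metric.cthickening_mono hδ.2.2.le _).trans hδ₃)⟩
  refine ⟨φ, fun x => ⟨?_, ?_⟩⟩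
  · rw [← dist_eq_norm]
    exact ρ.dist_normed_convolution_le hv.continuous.aestronglyMeasurable
      fun y hy => (hδ₁ (hy.trans hδ.1)).le
  · rw [← (InnerProductSpace.toDual ℝ E).norm_map, map_sub, toDual_gradient, toDual_gradient,
      ← dist_eq_norm, show fderiv ℝ φ x = _ from
        (hc.hasFDerivAt_convolution_right (ContinuousLinearMap.lsmul ℝ ℝ)
          ((ρ.continuous_normed (μ := volume)).locallyIntegrable (μ := volume)) hv x).fderiv]
    exact ρ.dist_normed_convolution_le (μ := volume) hfc.aestronglyMeasurable
      fun y hy => (hδ₂ (hy.trans hδ.2.1)).le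

end Mollification

section WeakDerivatives

theorem ae_eq_of_integral_mul_testFunction {E : Type*} [NormedAddCommGroup E]
    [InnerProductSpace ℝ E] [FiniteDimensional ℝ E] [MeasurableSpace E] [BorelSpace E]
    {μ : Measure E} {Ω : Opens E} {f g : E → ℝ} (hf : LocallyIntegrableOn f Ω μ)
    (hg : LocallyIntegrableOn g Ω μ)
    (h : ∀ φ : 𝓓(Ω, ℝ), ∫ x in (Ω : Set E), f x * φ x ∂μ = ∫ x in (Ω : Set E), g x * φ x ∂μ) :
    f =ᵐ[μ.restrict Ω] g := by
  have hzero : ∀ᵐ x ∂μ, x ∈ (Ω : Set E) → (f - g) x = 0 := by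
    refine Ω.isOpen.ae_eq_zero_of_integral_contDiff_smul_eq_zero (hf.sub hg)
      fun φ hφ hφc hφs => ?_
    let η : 𝓓(Ω, ℝ) := ⟨φ, hφ, hφc, hφs⟩
    calc ∫ x, φ x • (f - g) x ∂μ = ∫ x in (Ω : Set E), (f x * η x - g x * η x) ∂μ := by
          rw [setIntegral_eq_integral_of_forall_compl_eq_zero fun x hx => by
            simp [testFunction_eq_zero_of_notMem η hx]]
          exact integral_congr_ae (.of_forall fun x => by
            simp only [smul_eq_mul, Pi.sub_apply, ← sub_mul, mul_comm (φ x)]; rfl)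
      _ = 0 := by
          rw [integral_sub (integrable_mul_testFunction hf η).integrableOn
            (integrable_mul_testFunction hg η).integrableOn, h η, sub_self]
  filter_upwards [(ae_restrict_iff' Ω.isOpen.measurableSet).2 hzero] with x hx
  exact sub_eq_zero.1 hx

theorem locallyIntegrableOn_inner_const {X E : Type*} [TopologicalSpace X] [MeasurableSpace X]
    {μ : Measure X} [NormedAddCommGroup E] [InnerProductSpace ℝ E] {s : Set X} {G : X → E}
    (hG : LocallyIntegrableOn G s μ) (v : E) :
    LocallyIntegrableOn (fun x => inner ℝ (G x) v) s μ := fun x hx => by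
  obtain ⟨t, ht, hGt⟩ := hG x hx
  exact ⟨t, ht, hGt.inner_const v⟩

variable {Ω : Opens Plane} {u L : Plane → ℝ} {G G' : Plane → Plane}

local notation "𝐞" => EuclideanSpace.basisFun (Fin 2) ℝ

theorem HasWeakGradient.ae_eq (h : HasWeakGradient Ω u G) (h' : HasWeakGradient Ω u G') :
    G =ᵐ[volOn Ω] G' := by
  have hcomp (i : Fin 2) :
      (fun x => inner ℝ (G x) (𝐞 i)) =ᵐ[volOn Ω] fun x => inner ℝ (G' x) (𝐞 i) :=
    ae_eq_of_integral_mul_testFunction (locallyIntegrableOn_inner_const h.2.1 _)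
      (locallyIntegrableOn_inner_const h'.2.1 _)
      fun φ => neg_injective ((h.2.2 φ _).symm.trans (h'.2.2 φ _))
  filter_upwards [ae_all_iff.2 hcomp] with x hx
  exact InnerProductSpace.ext_inner_right_basis 𝐞.toBasis fun i => by simpa using hx i

theorem MemW10.congr {p : ℝ≥0∞} {U U' : Plane → Plane} (hu : MemW10 Ω p u U)
    (h : U =ᵐ[volOn Ω] U') (hp : 1 ≤ p) : MemW10 Ω p u U' := by
  obtain ⟨⟨hu, hU, -⟩, φ, hφ, hdφ⟩ := hu
  exact .of_tendsto hp hu (hU.ae_eq h) φ hφ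
    (hdφ.congr fun n => eLpNorm_congr_ae (h.mono fun x hx => by simp only [hx]))

theorem laplacian_testFunction (φ : 𝓓(Ω, ℝ)) (x : Plane) :
    Δ (φ : Plane → ℝ) x =
      ∑ i, inner ℝ (gradient (dirDerivTestFunction φ (𝐞 i)) x) (𝐞 i) := by
  rw [InnerProductSpace.laplacian_eq_iteratedFDeriv_orthonormalBasis φ 𝐞]
  refine Finset.sum_congr rfl fun i _ => ?_
  have hφ' : DifferentiableAt ℝ (fderiv ℝ φ) x :=
    (φ.contDiff.fderiv_right (m := (⊤ : ℕ∞)) (by simp)).differentiable (by simp) x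
  rw [iteratedFDeriv_two_apply, inner_gradient_left,
    funext (dirDerivTestFunction_apply φ (𝐞 i)),
    fderiv_clm_apply hφ' (differentiableAt_const _)]
  simp

theorem HasWeakGradient.integral_mul_laplacian (h : HasWeakGradient Ω u G) (φ : 𝓓(Ω, ℝ)) :
    ∫ x in (Ω : Set Plane), u x * Δ (φ : Plane → ℝ) x =
      - ∑ i, ∫ x in (Ω : Set Plane), inner ℝ (G x) (𝐞 i) * fderiv ℝ φ x (𝐞 i) := by
  simp only [laplacian_testFunction, Finset.mul_sum]
  rw [integral_finsetSum, ← Finset.sum_neg_distrib]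
  · exact Finset.sum_congr rfl fun i _ => h.2.2 _ _
  · simp only [inner_gradient_left]
    exact fun i _ => (integrable_mul_testFunction h.1
      (dirDerivTestFunction (dirDerivTestFunction φ (𝐞 i)) (𝐞 i))).integrableOn

theorem HasWeakLaplacian.hasWeakNegDiv (hL : HasWeakLaplacian Ω u L)
    (h : HasWeakGradient Ω u G) : HasWeakNegDiv Ω G (fun x => -L x) := by
  intro φ
  simp only [neg_mul]
  rw [integral_neg, ← hL.2.2 φ, h.integral_mul_laplacian, neg_neg, ← integral_finsetSum]
  · refine integral_congr_ae (.of_forall fun x => ?_)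
    refine (𝐞.sum_inner_mul_inner _ _).symm.trans (Finset.sum_congr rfl fun i _ => ?_)
    rw [real_inner_comm (gradient φ x), inner_gradient_left]
  · exact fun i _ => (integrable_mul_testFunction (locallyIntegrableOn_inner_const h.2.1 _)
      (dirDerivTestFunction φ (𝐞 i))).integrableOn

theorem MemW2.integrable_laplacian [IsFiniteMeasure (volOn Ω)] {k : ℝ≥0∞} (hk : 1 ≤ k)
    (hu : MemW2 Ω k u) (hL : HasWeakLaplacian Ω u L) : Integrable L (volOn Ω) := by
  obtain ⟨G, ⟨-, -, hG⟩, hH⟩ := hu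
  choose H hH using hH
  have hint (i : Fin 2) : Integrable (fun x => inner ℝ (H i x) (𝐞 i)) (volOn Ω) :=
    ((hH i).2.1.inner_const _).integrable hk
  have hsum : Integrable (fun x => ∑ i, inner ℝ (H i x) (𝐞 i)) (volOn Ω) :=
    integrable_finsetSum _ fun i _ => hint i
  have hloc {f : Plane → ℝ} (hf : Integrable f (volOn Ω)) : LocallyIntegrableOn f Ω volume :=
    IntegrableOn.locallyIntegrableOn hf
  refine hsum.congr (ae_eq_of_integral_mul_testFunction (hloc hsum) hL.2.1 fun φ => ?_)
  rw [← hL.2.2 φ, hG.integral_mul_laplacian φ, ← Finset.sum_neg_distrib]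
  simp only [Finset.sum_mul]
  rw [integral_finsetSum]
  · refine Finset.sum_congr rfl fun i _ => ?_
    rw [← neg_inj, neg_neg, ← (hH i).2.2.2.2 φ (𝐞 i)]
    simp [EuclideanSpace.inner_single_right, inner_gradient_left]
  · exact fun i _ => (integrable_mul_testFunction (hloc (hint i)) φ).integrableOn

end WeakDerivatives

section Truncation

theorem exists_contDiff_truncation {R : ℝ} (hR : 0 < R) :
    ∃ (τ : ℝ → ℝ) (M B : ℝ), ContDiff ℝ (⊤ : ℕ∞) τ ∧ (∀ t, |t| ≤ R → τ t = t) ∧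
      (∀ t, R + 1 ≤ |t| → τ t = 0) ∧ (∀ t, |deriv τ t| ≤ M) ∧ ∀ t, |τ t| ≤ B := by
  let b : ContDiffBump (0 : ℝ) := ⟨R, R + 1, hR, lt_add_one R⟩
  have hτ : ContDiff ℝ (⊤ : ℕ∞) fun t => t * b t := contDiff_id.mul b.contDiff
  have hc : HasCompactSupport fun t => t * b t := b.hasCompactSupport.mul_left
  obtain ⟨B, hB⟩ := hc.exists_bound_of_continuous hτ.continuous
  obtain ⟨M, hM⟩ := hc.deriv.exists_bound_of_continuous (hτ.continuous_deriv (by simp))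
  refine ⟨_, M, B, hτ, fun t ht => ?_, fun t ht => ?_, hM, hB⟩
  · rw [b.one_of_mem_closedBall (by simpa using ht), mul_one]
  · rw [b.zero_of_le_dist (by simpa using ht), mul_zero]

theorem exists_seq_contDiff_eventuallyEq_zero_eventuallyEq_id :
    ∃ (ψ : ℕ → ℝ → ℝ) (M : ℝ), (∀ n, ContDiff ℝ (⊤ : ℕ∞) (ψ n)) ∧ (∀ n, ψ n =ᶠ[𝓝 0] 0) ∧
      (∀ n t, |deriv (ψ n) t| ≤ M) ∧ ∀ t, t ≠ 0 → ∀ᶠ n in atTop, ψ n =ᶠ[𝓝 t] id := by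
  obtain ⟨τ, M, -, hτ, hτ_id, hτ_zero, hM, -⟩ := exists_contDiff_truncation one_pos
  have hscale (n : ℕ) : ContDiff ℝ (⊤ : ℕ∞) fun t : ℝ => (n + 1 : ℝ) * t :=
    contDiff_const.mul contDiff_id
  have habs (n : ℕ) (t : ℝ) : |(n + 1) * t| = (n + 1) * |t| := by
    rw [abs_mul, abs_of_pos (by positivity)]
  refine ⟨fun n t => t - (n + 1 : ℝ)⁻¹ * τ ((n + 1) * t), 1 + M,
    fun n => contDiff_id.sub (contDiff_const.mul (hτ.comp (hscale n))), fun n => ?_,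
    fun n t => ?_, fun t ht => ?_⟩
  · have hsmall : ∀ᶠ t : ℝ in 𝓝 0, |(n + 1) * t| < 1 :=
      (hscale n).continuous.abs.continuousAt.eventually_lt_const (by simp)
    filter_upwards [hsmall] with t ht
    rw [hτ_id _ ht.le, inv_mul_cancel_left₀ (by positivity), sub_self, Pi.zero_apply]
  · have hderiv : HasDerivAt (fun t : ℝ => t - (n + 1 : ℝ)⁻¹ * τ ((n + 1) * t))
        (1 - deriv τ ((n + 1) * t)) t := by
      have hcomp := (hτ.differentiable (by simp) ((n + 1) * t)).hasDerivAt.comp t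
        ((hasDerivAt_id t).const_mul (n + 1 : ℝ))
      refine ((hasDerivAt_id t).sub (hcomp.const_mul (n + 1 : ℝ)⁻¹)).congr_deriv ?_
      rw [mul_one, mul_comm (deriv τ _), inv_mul_cancel_left₀ (by positivity)]
    rw [hderiv.deriv]
    exact (abs_sub _ _).trans (by simpa using hM _)
  · have hlarge : Tendsto (fun n : ℕ => (n + 1 : ℝ) * |t|) atTop atTop :=
      (tendsto_atTop_add_const_right _ _ tendsto_natCast_atTop_atTop).atTop_mul_const (by simpa)
    filter_upwards [hlarge.eventually_gt_atTop (1 + 1)] with n hn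
    have hnear : ∀ᶠ s : ℝ in 𝓝 t, 1 + 1 < |(n + 1) * s| :=
      (hscale n).continuous.abs.continuousAt.eventually_const_lt (hn.trans_eq (habs n t).symm)
    filter_upwards [hnear] with s hs
    rw [hτ_zero _ hs.le, mul_zero, sub_zero, id]

section Approximation

variable {α E : Type*} [MeasurableSpace α] {μ : Measure α} {p : ℝ≥0∞} {f : α → ℝ}
  {ψ : ℕ → ℝ → ℝ} {M : ℝ}

theorem tendsto_eLpNorm_comp_sub (hp0 : p ≠ 0) (hp : p ≠ ∞) (hf : MemLp f p μ)
    (hψ : ∀ n, Differentiable ℝ (ψ n)) (hM : ∀ n t, |deriv (ψ n) t| ≤ M) (hψ0 : ∀ n, ψ n 0 = 0)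
    (hψ_id : ∀ t, t ≠ 0 → ∀ᶠ n in atTop, ψ n t = t) :
    Tendsto (fun n => eLpNorm (fun x => ψ n (f x) - f x) p μ) atTop (𝓝 0) := by
  refine tendsto_eLpNorm_of_dominated hp0 hp
    (fun n => ((hψ n).continuous.comp_aestronglyMeasurable hf.1).sub hf.1)
    (hf.norm.const_mul (M + 1)) (fun n => .of_forall fun x => ?_)
    (.of_forall fun x => tendsto_const_nhds.congr' ?_)
  · rw [add_one_mul]
    refine (norm_sub_le _ _).trans (add_le_add_left ?_ _)
    simpa [hψ0] using norm_sub_le_of_abs_deriv_le (hψ n) (hM n) (f x) 0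
  · rcases eq_or_ne (f x) 0 with h0 | h0
    · exact .of_forall fun n => by simp [h0, hψ0]
    · filter_upwards [hψ_id _ h0] with n hn
      rw [hn, sub_self]

theorem tendsto_eLpNorm_deriv_comp_smul_sub_indicator [NormedAddCommGroup E] [NormedSpace ℝ E]
    {F : α → E} (hp0 : p ≠ 0) (hp : p ≠ ∞) (hf : AEStronglyMeasurable f μ) (hF : MemLp F p μ)
    (hψ : ∀ n, ContDiff ℝ 1 (ψ n)) (hM : ∀ n t, |deriv (ψ n) t| ≤ M)
    (hψ0 : ∀ n, deriv (ψ n) 0 = 0) (hψ_id : ∀ t, t ≠ 0 → ∀ᶠ n in atTop, deriv (ψ n) t = 1) :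
    Tendsto (fun n => eLpNorm (fun x => deriv (ψ n) (f x) • F x - {x | f x ≠ 0}.indicator F x) p μ)
      atTop (𝓝 0) := by
  have hnull : NullMeasurableSet {x | f x ≠ 0} μ :=
    (hf.nullMeasurableSet_eq_fun aestronglyMeasurable_const).compl
  refine tendsto_eLpNorm_of_dominated hp0 hp
    (fun n => (memLp_deriv_comp_smul hf hF (hψ n) (hM n)).1.sub (hF.1.indicator₀ hnull))
    (hF.norm.const_mul (M + 1)) (fun n => .of_forall fun x => ?_)
    (.of_forall fun x => tendsto_const_nhds.congr' ?_)
  · rw [add_one_mul]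
    refine (norm_sub_le _ _).trans (add_le_add ?_ (norm_indicator_le_norm_self _ _))
    rw [norm_smul]
    exact mul_le_mul_of_nonneg_right (hM n _) (norm_nonneg _)
  · rcases eq_or_ne (f x) 0 with h0 | h0
    · exact .of_forall fun n => by simp [h0, hψ0]
    · filter_upwards [hψ_id _ h0] with n hn
      simp [h0, hn]

end Approximation

theorem tsupport_indicator_comp_subset {X Y Z : Type*} [TopologicalSpace X] [TopologicalSpace Y]
    [Zero Y] [Zero Z] {s : Set X} (hs : IsOpen s) {u : X → Y} (hu : ContinuousOn u (closure s))
    (hu0 : ∀ x ∈ frontier s, u x = 0) {ψ : Y → Z} (hψ : ψ =ᶠ[𝓝 0] 0) :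
    tsupport (s.indicator (ψ ∘ u)) ⊆ s := by
  obtain ⟨t, hψt, ht, h0t⟩ := eventually_nhds_iff.1 hψ
  have hclosed : IsClosed (closure s ∩ u ⁻¹' tᶜ) :=
    hu.preimage_isClosed_of_isClosed isClosed_closure ht.isClosed_compl
  refine (closure_minimal (fun x hx => ?_) hclosed).trans fun x hx => ?_
  · have hxs : x ∈ s := mem_of_indicator_ne_zero hx
    refine ⟨subset_closure hxs, fun hxt => hx ?_⟩
    rw [indicator_of_mem hxs]
    exact hψt _ hxt
  · by_contra hxs
    refine hx.2 ?_
    rwa [hu0 x (by rw [hs.frontier_eq]; exact ⟨hx.1, hxs⟩)]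

theorem contDiff_of_contDiffOn_of_tsupport_subset {𝕜 E F : Type*} [NontriviallyNormedField 𝕜]
    [NormedAddCommGroup E] [NormedSpace 𝕜 E] [NormedAddCommGroup F] [NormedSpace 𝕜 F]
    {n : WithTop ℕ∞} {s : Set E} (hs : IsOpen s) {f : E → F} (hf : ContDiffOn 𝕜 n f s)
    (hfs : tsupport f ⊆ s) : ContDiff 𝕜 n f :=
  contMDiff_iff_contDiff.1 <| contMDiff_of_tsupport fun _ hx =>
    (hf.contDiffAt (hs.mem_nhds (hfs hx))).contMDiffAt

theorem contDiffOn_one_of_hasGradientAt {E : Type*} [NormedAddCommGroup E]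
    [InnerProductSpace ℝ E] [CompleteSpace E] {s : Set E} (hs : IsOpen s) {u : E → ℝ} {D : E → E}
    (hu : ∀ x ∈ s, HasGradientAt u (D x) x) (hD : ContinuousOn D s) : ContDiffOn ℝ 1 u s := by
  rw [show (1 : WithTop ℕ∞) = 0 + 1 from rfl, contDiffOn_succ_iff_fderiv_of_isOpen hs]
  refine ⟨fun x hx => (hu x hx).differentiableAt.differentiableWithinAt, by simp,
    contDiffOn_zero.2 ?_⟩
  exact ((InnerProductSpace.toDual ℝ E).continuous.comp_continuousOn hD).congr
    fun x hx => (hu x hx).hasFDerivAt.fderiv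

end Truncation

section DirichletClass

variable {Ω : Opens Plane} {p : ℝ≥0∞} {u : Plane → ℝ} {D : Plane → Plane}

theorem ae_volOn_of_forall_mem {P : Plane → Prop} (h : ∀ x ∈ Ω, P x) : ∀ᵐ x ∂volOn Ω, P x :=
  (ae_restrict_iff' Ω.isOpen.measurableSet).2 (.of_forall h)

theorem MemW10.of_contDiff [IsFiniteMeasure (volOn Ω)] (hp : 1 ≤ p) (hp_top : p ≠ ∞)
    (hu : ContDiff ℝ 1 u) (hc : HasCompactSupport u) (hs : tsupport u ⊆ Ω) :
    MemW10 Ω p u (gradient u) := by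
  have hp0 : p ≠ 0 := (zero_lt_one.trans_le hp).ne'
  have hup : MemLp u p (volOn Ω) := hu.continuous.memLp_of_hasCompactSupport hc
  have hDup : MemLp (gradient u) p (volOn Ω) :=
    ((InnerProductSpace.toDual ℝ Plane).symm.continuous.comp
      (hu.continuous_fderiv (by simp))).memLp_of_hasCompactSupport
        ((hc.fderiv (𝕜 := ℝ)).comp_left (map_zero _))
  choose φ hφ using fun n : ℕ =>
    exists_testFunction_near hu hc hs (ε := 1 / (n + 1)) (by positivity)
  have hle (n : ℕ) : (1 : ℝ) / (n + 1) ≤ 1 := by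
    simpa using Nat.one_div_le_one_div (α := ℝ) (Nat.zero_le n)
  refine .of_tendsto hp hup hDup φ ?_ ?_
  · exact tendsto_eLpNorm_of_dominated hp0 hp_top
      (fun n => ((memLp_testFunction (φ n) p).sub hup).1) (memLp_const 1)
      (fun n => .of_forall fun x => (hφ n x).1.trans (hle n))
      (.of_forall fun x => squeeze_zero_norm (fun n => (hφ n x).1)
        tendsto_one_div_add_atTop_nhds_zero_nat)
  · exact tendsto_eLpNorm_of_dominated hp0 hp_top
      (fun n => ((memLp_gradient_testFunction (φ n) p).sub hDup).1) (memLp_const 1)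
      (fun n => .of_forall fun x => (hφ n x).2.trans (hle n))
      (.of_forall fun x => squeeze_zero_norm (fun n => (hφ n x).2)
        tendsto_one_div_add_atTop_nhds_zero_nat)

theorem memW10_indicator_comp (hΩ : Bornology.IsBounded (Ω : Set Plane)) (hp : 1 ≤ p)
    (hp_top : p ≠ ∞) (hu : ContinuousOn u (closure (Ω : Set Plane)))
    (hu0 : ∀ x ∈ frontier (Ω : Set Plane), u x = 0) (hD : ∀ x ∈ Ω, HasGradientAt u (D x) x)
    (hDc : ContinuousOn D Ω) {ψ : ℝ → ℝ} (hψ : ContDiff ℝ (⊤ : ℕ∞) ψ) (hψ0 : ψ =ᶠ[𝓝 0] 0) :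
    MemW10 Ω p ((Ω : Set Plane).indicator (ψ ∘ u)) (fun x => deriv ψ (u x) • D x) := by
  have := isFiniteMeasure_volOn hΩ
  have hs := tsupport_indicator_comp_subset Ω.isOpen hu hu0 hψ0
  have hc : HasCompactSupport ((Ω : Set Plane).indicator (ψ ∘ u)) :=
    hΩ.isCompact_closure.of_isClosed_subset (isClosed_tsupport _) (hs.trans subset_closure)
  have hC1 : ContDiffOn ℝ 1 ((Ω : Set Plane).indicator (ψ ∘ u)) Ω :=
    ((hψ.of_le (by simp)).comp_contDiffOn (contDiffOn_one_of_hasGradientAt Ω.isOpen hD hDc)).congr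
      fun x hx => indicator_of_mem hx _
  refine (MemW10.of_contDiff hp hp_top (contDiff_of_contDiffOn_of_tsupport_subset Ω.isOpen hC1 hs)
    hc hs).congr (ae_volOn_of_forall_mem fun x hx => ?_) hp
  rw [((eqOn_indicator (s := (Ω : Set Plane))).eventuallyEq_of_mem
    (Ω.isOpen.mem_nhds hx)).gradient_eq, gradient_comp (hψ.differentiable (by simp) _)
    (hD x hx).differentiableAt, (hD x hx).gradient]

theorem memW10_of_continuousOn (hΩ : Bornology.IsBounded (Ω : Set Plane)) (hp : 1 ≤ p)
    (hp_top : p ≠ ∞) (hu : ContinuousOn u (closure (Ω : Set Plane)))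
    (hu0 : ∀ x ∈ frontier (Ω : Set Plane), u x = 0) (hD : ∀ x ∈ Ω, HasGradientAt u (D x) x)
    (hDc : ContinuousOn D Ω) (hDp : MemLp D p (volOn Ω)) : MemW10 Ω p u D := by
  have := isFiniteMeasure_volOn hΩ
  have hp0 : p ≠ 0 := (zero_lt_one.trans_le hp).ne'
  obtain ⟨T, hT⟩ := hΩ.isCompact_closure.exists_bound_of_continuousOn hu
  have hum : AEStronglyMeasurable u (volOn Ω) :=
    (hu.mono subset_closure).aestronglyMeasurable Ω.isOpen.measurableSet
  have hup : MemLp u p (volOn Ω) :=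
    .of_bound hum T (ae_volOn_of_forall_mem fun x hx => hT x (subset_closure hx))
  obtain ⟨ψ, M, hψ, hψ0, hM, hψ_id⟩ := exists_seq_contDiff_eventuallyEq_zero_eventuallyEq_id
  have hψ_diff (n : ℕ) : Differentiable ℝ (ψ n) := (hψ n).differentiable (by simp)
  have hv := fun n => memW10_indicator_comp hΩ hp hp_top hu hu0 hD hDc (hψ n) (hψ0 n)
  have hnull : NullMeasurableSet {x | u x ≠ 0} (volOn Ω) :=
    (hum.nullMeasurableSet_eq_fun aestronglyMeasurable_const).compl
  -- The gradients converge to `D` off the zero set of `u`, and to `0` on it; since weak gradients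
  -- are unique, `D` vanishes almost everywhere on this zero set.
  have hlim : MemW10 Ω p u ({x | u x ≠ 0}.indicator D) := by
    refine .of_tendsto_memW10 hp hup (hDp.of_le (hDp.1.indicator₀ hnull)
      (.of_forall fun x => norm_indicator_le_norm_self _ _)) hv ?_ ?_
    · refine (tendsto_eLpNorm_comp_sub hp0 hp_top hup hψ_diff hM
        (fun n => (hψ0 n).self_of_nhds) fun t ht => (hψ_id t ht).mono fun n h =>
          h.self_of_nhds).congr fun n => eLpNorm_congr_ae (ae_volOn_of_forall_mem fun x hx => ?_)
      exact congrArg (· - u x) (indicator_of_mem (s := (Ω : Set Plane)) hx (ψ n ∘ u)).symm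
    · exact tendsto_eLpNorm_deriv_comp_smul_sub_indicator hp0 hp_top hum hDp
        (fun n => (hψ n).of_le (by simp)) hM (fun n => by simp [(hψ0 n).deriv_eq])
        fun t ht => (hψ_id t ht).mono fun n h => by simp [h.deriv_eq]
  have hweak : HasWeakGradient Ω u D :=
    ⟨locallyIntegrableOn_of_locallyIntegrable_restrict (hup.locallyIntegrable hp),
      locallyIntegrableOn_of_locallyIntegrable_restrict (hDp.locallyIntegrable hp),
      fun φ v => integral_mul_inner_gradient_testFunction φ hD hDc v⟩
  exact hlim.congr (hlim.1.2.2.ae_eq hweak) hp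

theorem DirichletClass.memW10 (hΩ : Bornology.IsBounded (Ω : Set Plane)) (hp : 1 ≤ p)
    (hp_top : p ≠ ∞) {k : ℝ≥0∞} {ε : ℝ≥0} (hε : 0 < ε) (hu : DirichletClass Ω k ε u) :
    MemW10 Ω p u (gradient u) := by
  have := isFiniteMeasure_volOn hΩ
  obtain ⟨-, ⟨hc, D, hD, M, hM⟩, h0⟩ := hu
  have hDc := hM.continuousOn hε
  obtain ⟨B, hB⟩ := hΩ.isCompact_closure.exists_bound_of_continuousOn hDc
  have hDp : MemLp D p (volOn Ω) :=
    .of_bound ((hDc.mono subset_closure).aestronglyMeasurable Ω.isOpen.measurableSet) B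
      (ae_volOn_of_forall_mem fun x hx => hB x (subset_closure hx))
  exact (memW10_of_continuousOn hΩ hp hp_top hc h0 hD (hDc.mono subset_closure) hDp).congr
    (ae_volOn_of_forall_mem fun x hx => (hD x hx).gradient.symm) hp

end DirichletClass

section WeakSolution

theorem exists_forall_inner_eq_of_norm_le_mul {W H : Type*} [NormedAddCommGroup W]
    [InnerProductSpace ℝ W] [CompleteSpace W] [NormedAddCommGroup H] [InnerProductSpace ℝ H]
    (P : W →L[ℝ] H) {C : ℝ} (hP : ∀ w, ‖w‖ ≤ C * ‖P w‖) (ℓ : W →L[ℝ] ℝ) :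
    ∃ v, ∀ w, inner ℝ (P v) (P w) = ℓ w := by
  let B : W →L[ℝ] W →L[ℝ] ℝ := (innerSL ℝ).bilinearComp P P
  have hB : IsCoercive B := by
    refine ⟨(C ^ 2 + 1)⁻¹, by positivity, fun w => ?_⟩
    rw [show B w w = ‖P w‖ ^ 2 from real_inner_self_eq_norm_sq _, mul_assoc, ← sq,
      inv_mul_le_iff₀ (by positivity)]
    calc ‖w‖ ^ 2 ≤ (C * ‖P w‖) ^ 2 := by gcongr; exact hP w
      _ ≤ (C ^ 2 + 1) * ‖P w‖ ^ 2 := by nlinarith [sq_nonneg ‖P w‖]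
  refine ⟨hB.continuousLinearEquivOfBilin.symm ((InnerProductSpace.toDual ℝ W).symm ℓ),
    fun w => ?_⟩
  change B _ w = ℓ w
  rw [← hB.continuousLinearEquivOfBilin_apply, ContinuousLinearEquiv.apply_symm_apply,
    InnerProductSpace.toDual_symm_apply]

/-- The Hilbert space `L²(Ω) × L²(Ω; ℝ²)`, which contains `W_0^{1,2}(Ω)` as the closed subspace
of the pairs `(u, ∇u)`. -/
abbrev L2Pair (Ω : Opens Plane) : Type :=
  WithLp 2 (Lp ℝ 2 (volOn Ω) × Lp Plane 2 (volOn Ω))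

variable {Ω : Opens Plane} {f : Plane → Plane} {g : Plane → ℝ}

/-- The map `φ ↦ (φ, ∇φ)`; the closure of its range encodes `W_0^{1,2}(Ω)`. -/
noncomputable def testGraph (Ω : Opens Plane) : 𝓓(Ω, ℝ) →ₗ[ℝ] L2Pair Ω where
  toFun φ := WithLp.toLp 2
    ((memLp_testFunction φ 2).toLp φ, (memLp_gradient_testFunction φ 2).toLp (gradient φ))
  map_add' φ η := by
    rw [← WithLp.toLp_add, Prod.mk_add_mk, ← MemLp.toLp_add, ← MemLp.toLp_add]
    congr 2
    exact MemLp.toLp_congr _ _ (.of_forall fun x => gradient_testFunction_add φ η x)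
  map_smul' c φ := by
    rw [RingHom.id_apply, ← WithLp.toLp_smul, Prod.smul_mk, ← MemLp.toLp_const_smul,
      ← MemLp.toLp_const_smul]
    congr 2
    exact MemLp.toLp_congr _ _ (.of_forall fun x => gradient_testFunction_smul c φ x)

theorem memW10_of_mem_closure_range_testGraph {w : L2Pair Ω}
    (hw : w ∈ (LinearMap.range (testGraph Ω)).topologicalClosure) : MemW10 Ω 2 w.fst w.snd := by
  obtain ⟨s, hs, hlim⟩ := mem_closure_iff_seq_limit.1 (show w ∈ closure _ from hw)
  choose φ hφ using hs
  obtain rfl : (fun n => testGraph Ω (φ n)) = s := funext hφ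
  have hfst := ((WithLp.fstL 2 ℝ _ _).continuous.tendsto w).comp hlim
  have hsnd := ((WithLp.sndL 2 ℝ _ _).continuous.tendsto w).comp hlim
  rw [Lp.tendsto_Lp_iff_tendsto_eLpNorm'] at hfst hsnd
  refine .of_tendsto one_le_two (Lp.memLp _) (Lp.memLp _) φ (hfst.congr fun n => ?_)
    (hsnd.congr fun n => ?_)
  · exact eLpNorm_congr_ae ((memLp_testFunction (φ n) 2).coeFn_toLp.sub .rfl)
  · exact eLpNorm_congr_ae ((memLp_gradient_testFunction (φ n) 2).coeFn_toLp.sub .rfl)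

theorem exists_norm_le_mul_norm_snd (hΩ : Bornology.IsBounded (Ω : Set Plane)) :
    ∃ C : ℝ, ∀ w ∈ (LinearMap.range (testGraph Ω)).topologicalClosure, ‖w‖ ≤ C * ‖w.snd‖ := by
  obtain ⟨S, hS⟩ := exists_eLpNorm_testFunction_le_eLpNorm_gradient_two hΩ (m := 2) le_rfl
  refine ⟨√(S ^ 2 + 1), fun w hw => ?_⟩
  have hpoincare : ‖w.fst‖ ≤ S * ‖w.snd‖ := by
    have := (memW10_of_mem_closure_range_testGraph hw).eLpNorm_le one_le_two hS
    simpa [Lp.norm_def] using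
      ENNReal.toReal_mono (ENNReal.mul_ne_top ENNReal.coe_ne_top (Lp.eLpNorm_ne_top w.snd)) this
  refine le_of_sq_le_sq ?_ (by positivity)
  rw [WithLp.prod_norm_sq_eq_of_L2, mul_pow, Real.sq_sqrt (by positivity)]
  calc ‖w.fst‖ ^ 2 + ‖w.snd‖ ^ 2 ≤ (S * ‖w.snd‖) ^ 2 + ‖w.snd‖ ^ 2 := by gcongr
    _ = (S ^ 2 + 1) * ‖w.snd‖ ^ 2 := by ring

theorem inner_toLp {α E : Type*} [MeasurableSpace α] {μ : Measure α} [NormedAddCommGroup E]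
    [InnerProductSpace ℝ E] {f g : α → E} (hf : MemLp f 2 μ) (hg : MemLp g 2 μ) :
    inner ℝ (hf.toLp f) (hg.toLp g) = ∫ x, inner ℝ (f x) (g x) ∂μ := by
  rw [L2.inner_def]
  refine integral_congr_ae ?_
  filter_upwards [hf.coeFn_toLp, hg.coeFn_toLp] with x hx hx'
  rw [hx, hx']

theorem exists_memW10_hasWeakNegDiv_add (hΩ : Bornology.IsBounded (Ω : Set Plane))
    (hg : MemLp g 2 (volOn Ω)) (hf : MemLp f 2 (volOn Ω)) :
    ∃ (z : Plane → ℝ) (Z : Plane → Plane),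
      MemW10 Ω 2 z Z ∧ HasWeakNegDiv Ω (fun x => Z x + f x) g := by
  obtain ⟨C, hC⟩ := exists_norm_le_mul_norm_snd hΩ
  let W := (LinearMap.range (testGraph Ω)).topologicalClosure
  have : CompleteSpace W := (Submodule.isClosed_topologicalClosure _).completeSpace_coe
  obtain ⟨v, hv⟩ := exists_forall_inner_eq_of_norm_le_mul ((WithLp.sndL 2 ℝ _ _).comp W.subtypeL)
    (fun w => hC w w.2)
    ((innerSL ℝ (WithLp.toLp 2 (hg.toLp g, -hf.toLp f) : L2Pair Ω)).comp W.subtypeL)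
  refine ⟨_, _, memW10_of_mem_closure_range_testGraph v.2, fun φ => ?_⟩
  have hφ := memLp_testFunction (μ := volOn Ω) φ 2
  have hdφ := memLp_gradient_testFunction (μ := volOn Ω) φ 2
  have hvφ : inner ℝ (v : L2Pair Ω).snd (hdφ.toLp (gradient φ)) =
      inner ℝ (hg.toLp g) (hφ.toLp φ) + inner ℝ (-hf.toLp f) (hdφ.toLp (gradient φ)) :=
    (hv ⟨testGraph Ω φ, subset_closure ⟨φ, rfl⟩⟩).trans (WithLp.prod_inner_apply _ _)
  have hZ : inner ℝ (v : L2Pair Ω).snd (hdφ.toLp (gradient φ)) =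
      ∫ x in (Ω : Set Plane), inner ℝ ((v : L2Pair Ω).snd x) (gradient φ x) := by
    rw [← inner_toLp (Lp.memLp _) hdφ, Lp.toLp_coeFn]
  rw [hZ, inner_neg_left, inner_toLp, inner_toLp, eq_add_neg_iff_add_eq] at hvφ
  simp only [inner_add_left]
  rw [integral_add (integrable_inner_of_memLp (Lp.memLp _) hdφ) (integrable_inner_of_memLp hf hdφ),
    hvφ]
  simp [mul_comm]

theorem isDivSolution_iff_hasWeakNegDiv_add (hf : MemLp f 2 (volOn Ω)) {z : Plane → ℝ}
    {Z : Plane → Plane} :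
    IsDivSolution Ω f z Z ↔ MemW10 Ω 2 z Z ∧ HasWeakNegDiv Ω (fun x => Z x + f x) 0 := by
  refine and_congr_right fun hz => forall_congr' fun φ => ?_
  have hdφ := memLp_gradient_testFunction (μ := volOn Ω) φ 2
  simp only [inner_add_left]
  rw [integral_add (integrable_inner_of_memLp hz.1.2.1 hdφ) (integrable_inner_of_memLp hf hdφ)]
  simp [add_eq_zero_iff_eq_neg]

theorem IsDivSolution.integral_inner {z u : Plane → ℝ} {Z U : Plane → Plane}
    (hz : IsDivSolution Ω f z Z) (hf : MemLp f 2 (volOn Ω)) (hu : MemW10 Ω 2 u U) :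
    ∫ x in (Ω : Set Plane), inner ℝ (f x) (U x) = -∫ x in (Ω : Set Plane), inner ℝ (Z x) (U x) := by
  obtain ⟨hzZ, hdiv⟩ := (isDivSolution_iff_hasWeakNegDiv_add hf).1 hz
  have h := hdiv.integral_inner (hzZ.1.2.1.add hf) MemLp.zero hu
  simp only [inner_add_left] at h
  rw [integral_add (integrable_inner_of_memLp hzZ.1.2.1 hu.1.2.1)
    (integrable_inner_of_memLp hf hu.1.2.1)] at h
  exact eq_neg_of_add_eq_zero_right (by simpa using h)

end WeakSolution

section Duality

theorem ae_abs_le_of_forall_abs_setIntegral_le {α : Type*} [MeasurableSpace α] {μ : Measure α}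
    [IsFiniteMeasure μ] {z : α → ℝ} (hz : Integrable z μ) {T : ℝ}
    (h : ∀ s, MeasurableSet s → |∫ x in s, z x ∂μ| ≤ μ.real s * T) : ∀ᵐ x ∂μ, |z x| ≤ T := by
  have hle : z ≤ᵐ[μ] fun _ => T := ae_le_of_forall_setIntegral_le hz (integrable_const _)
    fun s hs _ => by
      rw [setIntegral_const, smul_eq_mul]
      exact (le_abs_self _).trans (h s hs)
  have hge : (fun x => -z x) ≤ᵐ[μ] fun _ => T :=
    ae_le_of_forall_setIntegral_le hz.neg (integrable_const _) fun s hs _ => by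
      rw [setIntegral_const, smul_eq_mul, integral_neg]
      exact (neg_le_abs _).trans (h s hs)
  filter_upwards [hle, hge] with x hx hx'
  exact abs_le'.2 ⟨hx, hx'⟩

theorem ae_abs_le_of_forall_abs_integral_mul_le {α : Type*} [MeasurableSpace α] {μ : Measure α}
    [IsFiniteMeasure μ] {z : α → ℝ} (hz : Integrable z μ) {T : ℝ}
    (h : ∀ g : α → ℝ, MemLp g ∞ μ → eLpNorm g 1 μ ≤ 1 → |∫ x, g x * z x ∂μ| ≤ T) :
    ∀ᵐ x ∂μ, |z x| ≤ T := by
  refine ae_abs_le_of_forall_abs_setIntegral_le hz fun s hs => ?_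
  rcases eq_or_ne (μ s) 0 with h0 | h0
  · simp [Measure.restrict_eq_zero.2 h0, measureReal_def, h0]
  have hpos : 0 < μ.real s := ENNReal.toReal_pos h0 (measure_ne_top _ _)
  have hnorm : eLpNorm (s.indicator fun _ => (μ.real s)⁻¹) 1 μ ≤ 1 := by
    rw [eLpNorm_indicator_const hs one_ne_zero ENNReal.one_ne_top, ← ofReal_measureReal,
      Real.enorm_of_nonneg (by positivity), ENNReal.toReal_one, div_one, ENNReal.rpow_one,
      ← ENNReal.ofReal_mul (by positivity), inv_mul_cancel₀ hpos.ne', ENNReal.ofReal_one]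
  have hmean := h _ (memLp_indicator_const ∞ hs _ (.inr (measure_ne_top _ _))) hnorm
  simp only [← indicator_mul_left] at hmean
  rwa [integral_indicator hs, integral_const_mul, abs_mul, abs_of_pos (inv_pos.2 hpos),
    inv_mul_le_iff₀ hpos] at hmean

theorem exists_holderConjugate_lt_two {p : ℝ≥0∞} (hp : 2 < p) :
    ∃ q : ℝ≥0∞, q < 2 ∧ p.HolderConjugate q := by
  refine ⟨p.conjExponent, ?_, .conjExponent (one_le_two.trans hp.le)⟩
  have h1 : 1 < p - 1 := lt_tsub_iff_right.2 (by rwa [one_add_one_eq_two])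
  calc p.conjExponent = 1 + (p - 1)⁻¹ := rfl
    _ < 1 + 1 := ENNReal.add_lt_add_left ENNReal.one_ne_top (ENNReal.inv_lt_one.2 h1)
    _ = 2 := one_add_one_eq_two

variable {Ω : Opens Plane}

theorem exists_eLpNorm_top_le_of_isDivSolution (hΩ : Bornology.IsBounded (Ω : Set Plane))
    {p : ℝ≥0∞} (hp : 2 < p) : ∃ K : ℝ≥0, ∀ f : Plane → Plane, MemLp f p (volOn Ω) →
      ∀ (z : Plane → ℝ) (Z : Plane → Plane), IsDivSolution Ω f z Z →
        eLpNorm z ∞ (volOn Ω) ≤ K * eLpNorm f p (volOn Ω) := by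
  have := isFiniteMeasure_volOn hΩ
  obtain ⟨q, hq2, hpq⟩ := exists_holderConjugate_lt_two hp
  obtain ⟨K, hK⟩ := exists_eLpNorm_le_of_hasWeakNegDiv hΩ
    (ENNReal.HolderConjugate.one_le q p) hq2 1
  refine ⟨K, fun f hf z Z hz => ?_⟩
  have hK_top : K * eLpNorm f p (volOn Ω) ≠ ∞ := ENNReal.mul_ne_top ENNReal.coe_ne_top hf.2.ne
  -- For `-Δu = g`, `∫ z g = ∫ ∇z · ∇u = -∫ f · ∇u`, which the gradient estimate controls by `‖g‖₁`.
  have hbound : ∀ᵐ x ∂volOn Ω, |z x| ≤ (K * eLpNorm f p (volOn Ω)).toReal := by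
    refine ae_abs_le_of_forall_abs_integral_mul_le (hz.1.1.1.integrable one_le_two)
      fun g hg hg1 => ?_
    have hg2 : MemLp g 2 (volOn Ω) := hg.mono_exponent le_top
    obtain ⟨u, U, hu, hdiv⟩ := exists_memW10_hasWeakNegDiv_add hΩ hg2 (MemLp.zero (ε := Plane))
    simp only [Pi.zero_apply, add_zero] at hdiv
    have hdual : ∫ x in (Ω : Set Plane), inner ℝ (f x) (U x) =
        -∫ x in (Ω : Set Plane), g x * z x := by
      rw [hz.integral_inner (hf.mono_exponent hp.le) hu, ← hdiv.integral_inner hu.1.2.1 hg2 hz.1]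
      simp only [real_inner_comm]
    have hle : ‖∫ x in (Ω : Set Plane), g x * z x‖ₑ ≤ K * eLpNorm f p (volOn Ω) :=
      calc ‖∫ x in (Ω : Set Plane), g x * z x‖ₑ
          = ‖∫ x in (Ω : Set Plane), inner ℝ (f x) (U x)‖ₑ := by rw [hdual, enorm_neg]
        _ ≤ eLpNorm f p (volOn Ω) * eLpNorm U q (volOn Ω) :=
            enorm_integral_inner_le hf.1 hu.1.2.1.1
        _ ≤ K * eLpNorm f p (volOn Ω) := by
            rw [mul_comm]
            gcongr
            exact hK u g U hu hdiv (hg.integrable le_top) (by simpa using hg1)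
    simpa using ENNReal.toReal_mono hK_top hle
  calc eLpNorm z ∞ (volOn Ω) ≤ ENNReal.ofReal (K * eLpNorm f p (volOn Ω)).toReal := by
        rw [eLpNorm_exponent_top]
        exact eLpNormEssSup_le_of_ae_bound hbound
    _ ≤ K * eLpNorm f p (volOn Ω) := ENNReal.ofReal_toReal_le

theorem HasWeakNegDiv.integral_inner_of_ae_abs_le {p q : ℝ≥0∞} [p.HolderConjugate q]
    {F U : Plane → Plane} {g u : Plane → ℝ} (h : HasWeakNegDiv Ω F g) (hF : MemLp F p (volOn Ω))
    (hg : Integrable g (volOn Ω)) (hq : q ≠ ∞) (hu : MemW10 Ω q u U) {T : ℝ}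
    (hT : ∀ᵐ x ∂volOn Ω, |u x| ≤ T) :
    ∫ x in (Ω : Set Plane), inner ℝ (F x) (U x) = ∫ x in (Ω : Set Plane), g x * u x := by
  obtain ⟨τ, M, B, hτ, hτ_id, -, hM, hB⟩ :=
    exists_contDiff_truncation (R := |T| + 1) (by positivity)
  have hτ_eq {t : ℝ} (ht : |t| ≤ T) : τ =ᶠ[𝓝 t] id := by
    filter_upwards [continuous_abs.continuousAt.eventually_lt_const
      ((ht.trans (le_abs_self T)).trans_lt (lt_add_one _))] with s hs
    exact hτ_id s hs.le
  have htest := h.integral_inner_comp hF hg hq hu hτ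
    (hτ_id 0 (by simp only [abs_zero]; positivity)) hM hB
  convert htest using 1 <;> refine integral_congr_ae (hT.mono fun x hx => ?_)
  · simp only [(hτ_eq hx).deriv_eq, deriv_id, one_smul]
  · simp only [(hτ_eq hx).self_of_nhds, id]

end Duality

section Vitali

variable {ι α E : Type*} [MeasurableSpace α] {μ : Measure α} [NormedAddCommGroup E]
  {p r : ℝ≥0∞} {K : ℝ≥0}

theorem unifIntegrable_of_eLpNorm_le {f : ι → α → E} (hp : p ≠ 0) (hpr : p < r)
    (hf : ∀ i, AEStronglyMeasurable (f i) μ) (hK : ∀ i, eLpNorm (f i) r μ ≤ K) :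
    UnifIntegrable f p μ := by
  intro ε hε
  set e := 1 / p.toReal - 1 / r.toReal with he_def
  have he : 0 < e := by
    have hp' : 0 < p.toReal := ENNReal.toReal_pos hp hpr.ne_top
    rcases eq_or_ne r ∞ with rfl | hr
    · simpa [he_def] using hp'
    · have hpr' := (ENNReal.toReal_lt_toReal hpr.ne_top hr).2 hpr
      exact sub_pos.2 (one_div_lt_one_div_of_lt hp' hpr')
  have hlim : Tendsto (fun δ : ℝ => K * ENNReal.ofReal δ ^ e) (𝓝[>] 0) (𝓝 0) := by
    have := (ENNReal.continuous_ofReal.continuousWithinAt (s := Ioi 0) (x := 0)).tendsto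
      |>.ennrpow_const e
    simpa [he] using ENNReal.Tendsto.const_mul this (.inr ENNReal.coe_ne_top)
  obtain ⟨δ, hKδ, hδ⟩ := ((hlim.eventually (ge_mem_nhds (ENNReal.ofReal_pos.2 hε))).and
    self_mem_nhdsWithin).exists
  refine ⟨δ, hδ, fun i s hs hμs => ?_⟩
  calc eLpNorm (s.indicator (f i)) p μ = eLpNorm (f i) p (μ.restrict s) :=
        eLpNorm_indicator_eq_eLpNorm_restrict hs
    _ ≤ eLpNorm (f i) r (μ.restrict s) * μ s ^ e := by
        simpa [he_def] using
          eLpNorm_le_eLpNorm_mul_rpow_measure_univ (μ := μ.restrict s) hpr.le (hf i).restrict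
    _ ≤ K * ENNReal.ofReal δ ^ e := by
        gcongr
        exact (eLpNorm_mono_measure _ Measure.restrict_le_self).trans (hK i)
    _ ≤ ENNReal.ofReal ε := hKδ

theorem tendsto_eLpNorm_sub_of_tendstoInMeasure [IsFiniteMeasure μ] {f : ℕ → α → E} {g : α → E}
    (hp : 1 ≤ p) (hpr : p < r) (hf : ∀ n, AEStronglyMeasurable (f n) μ)
    (hK : ∀ n, eLpNorm (f n) r μ ≤ K) (hfg : TendstoInMeasure μ f atTop g) :
    MemLp g p μ ∧ Tendsto (fun n => eLpNorm (fun x => f n x - g x) p μ) atTop (𝓝 0) := by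
  have hg : MemLp g r μ := ⟨hfg.aestronglyMeasurable hf,
    (eLpNorm_le_of_tendstoInMeasure (.of_forall hK) hfg hf).trans_lt ENNReal.coe_lt_top⟩
  have hgp := hg.mono_exponent hpr.le
  exact ⟨hgp, tendsto_Lp_finite_of_tendstoInMeasure hp hpr.ne_top hf hgp
    (unifIntegrable_of_eLpNorm_le (zero_lt_one.trans_le hp).ne' hpr hf hK) hfg⟩

theorem tendstoInMeasure_of_forall_restrict [IsFiniteMeasure μ] {f : ι → α → E} {g : α → E}
    {l : Filter ι} {F : ℕ → Set α} (hF : ∀ n, MeasurableSet (F n)) (hmono : Monotone F)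
    (hcover : μ (⋃ n, F n)ᶜ = 0) (h : ∀ n, TendstoInMeasure (μ.restrict (F n)) f l g) :
    TendstoInMeasure μ f l g := by
  have htail : Tendsto (fun n => μ (F n)ᶜ) atTop (𝓝 0) := by
    have := tendsto_measure_iInter_atTop (fun n => (hF n).compl.nullMeasurableSet)
      (fun m n hmn => compl_subset_compl.2 (hmono hmn)) ⟨0, measure_ne_top μ _⟩
    rwa [← compl_iUnion, hcover] at this
  intro η hη
  refine ENNReal.tendsto_nhds_zero.2 fun ε hε => ?_
  have hε2 := ge_mem_nhds (ENNReal.half_pos hε.ne')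
  obtain ⟨n, hn⟩ := (htail.eventually hε2).exists
  filter_upwards [(h n η hη).eventually hε2] with i hi
  rw [Measure.restrict_apply' (hF n)] at hi
  calc μ {x | η ≤ edist (f i x) (g x)} ≤ μ ({x | η ≤ edist (f i x) (g x)} ∩ F n ∪ (F n)ᶜ) :=
        measure_mono fun x hx => (em (x ∈ F n)).imp (And.intro hx) id
    _ ≤ ε / 2 + ε / 2 := (measure_union_le _ _).trans (add_le_add hi hn)
    _ = ε := ENNReal.add_halves ε

end Vitali

theorem tendsto_eLpNorm_sub_of_forall_isCompact {Ω : Opens Plane}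
    (hΩ : Bornology.IsBounded (Ω : Set Plane)) {E : Type*} [NormedAddCommGroup E]
    {U : ℕ → Plane → E} {G : Plane → E} {q r : ℝ≥0∞} {K : ℝ≥0}
    (hU : ∀ i, AEStronglyMeasurable (U i) (volOn Ω)) (hG : AEStronglyMeasurable G (volOn Ω))
    (hq : 1 ≤ q) (hqr : q < r) (hK : ∀ i, eLpNorm (U i) r (volOn Ω) ≤ K)
    (h : ∀ S : Set Plane, IsCompact S → S ⊆ Ω →
      Tendsto (fun i => eLpNorm (fun x => U i x - G x) q (volume.restrict S)) atTop (𝓝 0)) :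
    Tendsto (fun i => eLpNorm (fun x => U i x - G x) q (volOn Ω)) atTop (𝓝 0) := by
  have := isFiniteMeasure_volOn hΩ
  obtain ⟨F, hF_closed, hF_sub, hF_cover, hF_mono⟩ := Ω.isOpen.exists_iUnion_isClosed
  refine (tendsto_eLpNorm_sub_of_tendstoInMeasure hq hqr hU hK
    (tendstoInMeasure_of_forall_restrict (fun n => (hF_closed n).measurableSet) hF_mono
      (by simp [hF_cover, Measure.restrict_apply Ω.isOpen.measurableSet.compl]) fun n => ?_)).2
  rw [Measure.restrict_restrict (hF_closed n).measurableSet, inter_eq_left.2 (hF_sub n)]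
  have hle : volume.restrict (F n) ≤ volOn Ω := Measure.restrict_mono_set _ (hF_sub n)
  exact tendstoInMeasure_of_tendsto_eLpNorm (zero_lt_one.trans_le hq).ne'
    (fun i => (hU i).mono_measure hle) (hG.mono_measure hle)
    (h _ (Metric.isCompact_of_isClosed_isBounded (hF_closed n) (hΩ.subset (hF_sub n))) (hF_sub n))

section Translation

variable {E F : Type*} [NormedAddCommGroup E] [NormedSpace ℝ E] [NormedAddCommGroup F]
  [NormedSpace ℝ F] [CompleteSpace F] {f : E → F}

theorem enorm_translate_sub_le (hf : ContDiff ℝ 1 f) (x t : E) :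
    ‖f (x - t) - f x‖ₑ ≤ ∫⁻ s in Icc (0 : ℝ) 1, ‖fderiv ℝ f (x - s • t)‖ₑ * ‖t‖ₑ := by
  have hline (s : ℝ) : HasDerivAt (fun s : ℝ => x - s • t) (-t) s := by
    simpa using ((hasDerivAt_id s).smul_const t).const_sub x
  have hderiv (s : ℝ) : HasDerivAt (fun s : ℝ => f (x - s • t)) (fderiv ℝ f (x - s • t) (-t)) s :=
    (hf.differentiable one_ne_zero _).hasFDerivAt.comp_hasDerivAt s (hline s)
  have hcont : Continuous fun s : ℝ => fderiv ℝ f (x - s • t) (-t) :=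
    ((hf.continuous_fderiv one_ne_zero).comp (by fun_prop)).clm_apply continuous_const
  have hftc := intervalIntegral.integral_eq_sub_of_hasDerivAt (a := 0) (b := 1)
    (fun s _ => hderiv s) (hcont.intervalIntegrable _ _)
  simp only [one_smul, zero_smul, sub_zero] at hftc
  rw [← hftc, intervalIntegral.integral_of_le zero_le_one, ← integral_Icc_eq_integral_Ioc]
  refine (enorm_integral_le_lintegral_enorm _).trans (lintegral_mono fun s => ?_)
  simpa using (fderiv ℝ f (x - s • t)).le_opENorm (-t)

variable [FiniteDimensional ℝ E] [MeasurableSpace E] [BorelSpace E] {μ : Measure E}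
  [μ.IsAddHaarMeasure]

theorem lintegral_enorm_translate_sub_le (hf : ContDiff ℝ 1 f) (t : E) :
    ∫⁻ x, ‖f (x - t) - f x‖ₑ ∂μ ≤ (∫⁻ x, ‖fderiv ℝ f x‖ₑ ∂μ) * ‖t‖ₑ := by
  have hcont : Continuous fun z : E × ℝ => ‖fderiv ℝ f (z.1 - z.2 • t)‖ₑ * ‖t‖ₑ :=
    (ENNReal.continuous_mul_const enorm_ne_top).comp
      ((hf.continuous_fderiv one_ne_zero).comp (by fun_prop)).enorm
  calc _ ≤ ∫⁻ x, (∫⁻ s in Icc (0 : ℝ) 1, ‖fderiv ℝ f (x - s • t)‖ₑ * ‖t‖ₑ) ∂μ :=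
        lintegral_mono fun x => enorm_translate_sub_le hf x t
    _ = ∫⁻ s in Icc (0 : ℝ) 1, ∫⁻ x, ‖fderiv ℝ f (x - s • t)‖ₑ * ‖t‖ₑ ∂μ :=
        lintegral_lintegral_swap hcont.measurable.aemeasurable
    _ = ∫⁻ _ in Icc (0 : ℝ) 1, (∫⁻ x, ‖fderiv ℝ f x‖ₑ ∂μ) * ‖t‖ₑ := by
        refine lintegral_congr fun _ => ?_
        rw [lintegral_mul_const' _ _ enorm_ne_top,
          lintegral_sub_right_eq_self (fun x => ‖fderiv ℝ f x‖ₑ)]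
    _ = _ := by simp

theorem lintegral_enorm_normed_convolution_sub_le (ρ : ContDiffBump (0 : E))
    (hf : ContDiff ℝ 1 f) :
    ∫⁻ x, ‖(∫ t, ρ.normed μ t • f (x - t) ∂μ) - f x‖ₑ ∂μ ≤
      ENNReal.ofReal ρ.rOut * ∫⁻ x, ‖fderiv ℝ f x‖ₑ ∂μ := by
  have hρ : ∫⁻ t, ‖ρ.normed μ t‖ₑ ∂μ = 1 := by
    simp [← ofReal_integral_norm_eq_lintegral_enorm ρ.integrable_normed,
      Real.norm_of_nonneg (ρ.nonneg_normed _), ρ.integral_normed]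
  have hcont : Continuous fun z : E × E => ‖ρ.normed μ z.2 • (f (z.1 - z.2) - f z.1)‖ₑ :=
    ((ρ.continuous_normed.comp continuous_snd).smul ((hf.continuous.comp (by fun_prop)).sub
      (hf.continuous.comp continuous_fst))).enorm
  have hmean (x : E) : (∫ t, ρ.normed μ t • f (x - t) ∂μ) - f x =
      ∫ t, ρ.normed μ t • (f (x - t) - f x) ∂μ := by
    have hint : Integrable (fun t => ρ.normed μ t • f (x - t)) μ :=
      (ρ.continuous_normed.smul (hf.continuous.comp (by fun_prop))).integrable_of_hasCompactSupport
        ρ.hasCompactSupport_normed.smul_right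
    simp only [smul_sub]
    rw [integral_sub hint (ρ.integrable_normed.smul_const _), integral_smul_const,
      ρ.integral_normed, one_smul]
  calc _ ≤ ∫⁻ x, ∫⁻ t, ‖ρ.normed μ t • (f (x - t) - f x)‖ₑ ∂μ ∂μ :=
        lintegral_mono fun x => by
          rw [hmean]; exact enorm_integral_le_lintegral_enorm _
    _ = ∫⁻ t, ∫⁻ x, ‖ρ.normed μ t • (f (x - t) - f x)‖ₑ ∂μ ∂μ :=
        lintegral_lintegral_swap hcont.measurable.aemeasurable
    _ ≤ ∫⁻ t, ‖ρ.normed μ t‖ₑ * (ENNReal.ofReal ρ.rOut * ∫⁻ x, ‖fderiv ℝ f x‖ₑ ∂μ) ∂μ := by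
        refine lintegral_mono fun t => ?_
        simp only [enorm_smul]
        rw [lintegral_const_mul' _ _ enorm_ne_top]
        by_cases ht : t ∈ Function.support (ρ.normed μ)
        · rw [ρ.support_normed_eq, mem_ball_zero_iff] at ht
          refine mul_le_mul_right ((lintegral_enorm_translate_sub_le hf t).trans ?_) _
          rw [mul_comm, ← ofReal_norm]
          gcongr
        · simp [Function.notMem_support.1 ht]
    _ = _ := by rw [lintegral_mul_const _ ρ.continuous_normed.measurable.enorm, hρ, one_mul]

end Translation

section WeakCompactness

theorem exists_subseq_tendsto_inner {H : Type*} [NormedAddCommGroup H] [InnerProductSpace ℝ H]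
    [CompleteSpace H] [SeparableSpace H] {f : ℕ → H} {A : ℝ} (hf : ∀ n, ‖f n‖ ≤ A) :
    ∃ (s : ℕ → ℕ) (f₀ : H), StrictMono s ∧
      ∀ h, Tendsto (fun n => inner ℝ (f (s n)) h) atTop (𝓝 (inner ℝ f₀ h)) := by
  obtain ⟨ℓ, -, s, hs, hlim⟩ := WeakDual.isSeqCompact_closedBall ℝ H (0 : StrongDual ℝ H) A
    (x := fun n => StrongDual.toWeakDual (InnerProductSpace.toDual ℝ H (f n)))
    (fun n => by simpa using hf n)
  refine ⟨s, (InnerProductSpace.toDual ℝ H).symm (WeakDual.toStrongDual ℓ), hs, fun h => ?_⟩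
  rw [InnerProductSpace.toDual_symm_apply]
  exact ((WeakDual.eval_continuous h).tendsto ℓ).comp hlim

theorem exists_subseq_tendsto_integral_mul {α : Type*} [MeasurableSpace α] {μ : Measure α}
    [MeasureTheory.IsSeparable μ] {f : ℕ → α → ℝ} {A : ℝ≥0} (hf : ∀ n, MemLp (f n) 2 μ)
    (hA : ∀ n, eLpNorm (f n) 2 μ ≤ A) :
    ∃ (s : ℕ → ℕ) (f₀ : α → ℝ), StrictMono s ∧ MemLp f₀ 2 μ ∧ ∀ h, MemLp h 2 μ →
      Tendsto (fun n => ∫ x, h x * f (s n) x ∂μ) atTop (𝓝 (∫ x, h x * f₀ x ∂μ)) := by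
  have : Fact ((2 : ℝ≥0∞) ≠ ∞) := ⟨ENNReal.ofNat_ne_top⟩
  obtain ⟨s, f₀, hs, hlim⟩ := exists_subseq_tendsto_inner (f := fun n => (hf n).toLp (f n))
    fun n => (Lp.norm_toLp _ (hf n)).trans_le (ENNReal.toReal_le_coe_of_le_coe (hA n))
  refine ⟨s, f₀, hs, Lp.memLp f₀, fun h hh => ?_⟩
  have := hlim (hh.toLp h)
  rw [← Lp.toLp_coeFn f₀ (Lp.memLp f₀)] at this
  simp only [inner_toLp] at this
  simpa using this

end WeakCompactness

theorem cauchySeq_of_forall_exists_edist_le {X : Type*} [PseudoEMetricSpace X] {x : ℕ → X}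
    (h : ∀ ε > 0, ∃ y : ℕ → X, CauchySeq y ∧ ∀ n, edist (x n) (y n) ≤ ε) : CauchySeq x := by
  refine EMetric.cauchySeq_iff.2 fun ε hε => ?_
  have hε3 : 0 < ε / 3 := ENNReal.div_pos hε.ne' ENNReal.ofNat_ne_top
  obtain ⟨δ, hδ, hδε⟩ := exists_between hε3
  obtain ⟨y, hy, hxy⟩ := h δ hδ
  obtain ⟨N, hN⟩ := EMetric.cauchySeq_iff.1 hy (ε / 3) hε3
  refine ⟨N, fun m hm n hn => ?_⟩
  calc edist (x m) (x n) ≤ edist (x m) (y m) + edist (y m) (y n) + edist (y n) (x n) :=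
        edist_triangle4 ..
    _ < ε / 3 + ε / 3 + ε / 3 := by
        gcongr
        · exact (hxy m).trans_lt hδε
        · exact hN m hm n hn
        · exact (edist_comm (y n) _).trans_lt ((hxy n).trans_lt hδε)
    _ = ε := ENNReal.add_thirds ε

/-- The mollification of the extension of `u` by zero outside `Ω`, used to prove compactness of
bounded sequences in `W_0^{1,1}(Ω)`. -/
noncomputable def mollify (Ω : Opens Plane) (ρ : ContDiffBump (0 : Plane)) (u : Plane → ℝ)
    (x : Plane) : ℝ :=
  ∫ y in (Ω : Set Plane), ρ.normed volume (x - y) * u y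

section Rellich

variable {Ω : Opens Plane} {ρ : ContDiffBump (0 : Plane)}

theorem mollify_testFunction (φ : 𝓓(Ω, ℝ)) (x : Plane) :
    mollify Ω ρ φ x = ∫ t, ρ.normed volume t • φ (x - t) := by
  rw [mollify, setIntegral_eq_integral_of_forall_compl_eq_zero fun y hy => by
    simp [testFunction_eq_zero_of_notMem φ hy],
    ← integral_sub_left_eq_self _ volume x]
  simp

theorem exists_abs_normed_le (ρ : ContDiffBump (0 : Plane)) :
    ∃ M : ℝ, ∀ x, |ρ.normed volume x| ≤ M :=
  ρ.hasCompactSupport_normed.exists_bound_of_continuous ρ.continuous_normed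

theorem memLp_normed_sub (hΩ : Bornology.IsBounded (Ω : Set Plane)) (x : Plane) (p : ℝ≥0∞) :
    MemLp (fun y => ρ.normed volume (x - y)) p (volOn Ω) := by
  have := isFiniteMeasure_volOn hΩ
  obtain ⟨M, hM⟩ := exists_abs_normed_le ρ
  exact .of_bound (ρ.continuous_normed.comp (by fun_prop)).aestronglyMeasurable M
    (.of_forall fun y => hM _)

theorem continuous_mollify {u : Plane → ℝ} (hu : Integrable u (volOn Ω)) :
    Continuous (mollify Ω ρ u) := by
  obtain ⟨M, hM⟩ := exists_abs_normed_le ρ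
  refine continuous_of_dominated (bound := fun y => M * ‖u y‖)
    (fun x => (ρ.continuous_normed.comp (by fun_prop)).aestronglyMeasurable.mul hu.1)
    (fun x => .of_forall fun y => ?_) (hu.norm.const_mul M)
    (.of_forall fun y => (ρ.continuous_normed.comp (by fun_prop)).mul continuous_const)
  rw [norm_mul]
  gcongr
  exact hM _

theorem exists_norm_mollify_le (Ω : Opens Plane) (ρ : ContDiffBump (0 : Plane)) :
    ∃ M : ℝ, 0 ≤ M ∧ ∀ u, Integrable u (volOn Ω) → ∀ x,
      ‖mollify Ω ρ u x‖ ≤ M * ∫ y in (Ω : Set Plane), ‖u y‖ := by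
  obtain ⟨M, hM⟩ := exists_abs_normed_le ρ
  refine ⟨M, (abs_nonneg _).trans (hM 0), fun u hu x => ?_⟩
  rw [← integral_const_mul]
  refine norm_integral_le_of_norm_le (hu.norm.const_mul M) (.of_forall fun y => ?_)
  rw [norm_mul]
  gcongr
  exact hM _

theorem memLp_mollify (hΩ : Bornology.IsBounded (Ω : Set Plane)) {u : Plane → ℝ}
    (hu : Integrable u (volOn Ω)) (p : ℝ≥0∞) : MemLp (mollify Ω ρ u) p (volOn Ω) := by
  have := isFiniteMeasure_volOn hΩ
  obtain ⟨M, -, hM⟩ := exists_norm_mollify_le Ω ρ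
  exact .of_bound (continuous_mollify hu).aestronglyMeasurable _ (.of_forall (hM u hu))

theorem tendsto_eLpNorm_mollify_sub (hΩ : Bornology.IsBounded (Ω : Set Plane)) {A : ℝ}
    {f : ℕ → Plane → ℝ} {f₀ : Plane → ℝ} (hf : ∀ n, Integrable (f n) (volOn Ω))
    (hf₀ : Integrable f₀ (volOn Ω)) (hA : ∀ n, ∫ x in (Ω : Set Plane), ‖f n x‖ ≤ A)
    (hlim : ∀ h, MemLp h 2 (volOn Ω) → Tendsto (fun n => ∫ x in (Ω : Set Plane), h x * f n x)
      atTop (𝓝 (∫ x in (Ω : Set Plane), h x * f₀ x))) :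
    Tendsto (fun n => eLpNorm (fun x => mollify Ω ρ (f n) x - mollify Ω ρ f₀ x) 1 (volOn Ω)) atTop
      (𝓝 0) := by
  have := isFiniteMeasure_volOn hΩ
  obtain ⟨M, hM0, hM⟩ := exists_norm_mollify_le Ω ρ
  have hpt (x : Plane) : Tendsto (fun n => mollify Ω ρ (f n) x) atTop (𝓝 (mollify Ω ρ f₀ x)) :=
    hlim _ (memLp_normed_sub hΩ x 2)
  have hbound (n : ℕ) (x : Plane) : ‖mollify Ω ρ (f n) x‖ ≤ M * A :=
    (hM _ (hf n) x).trans (by gcongr; exact hA n)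
  refine tendsto_eLpNorm_of_dominated one_ne_zero ENNReal.one_ne_top
    (fun n => ((continuous_mollify (hf n)).sub (continuous_mollify hf₀)).aestronglyMeasurable)
    (memLp_const (M * A + M * A))
    (fun n => .of_forall fun x => (norm_sub_le _ _).trans
      (add_le_add (hbound n x) (le_of_tendsto (hpt x).norm (.of_forall (hbound · x)))))
    (.of_forall fun x => ?_)
  simpa using (hpt x).sub_const (mollify Ω ρ f₀ x)

theorem eLpNorm_mollify_testFunction_sub_le (φ : 𝓓(Ω, ℝ)) :
    eLpNorm (fun x => mollify Ω ρ φ x - φ x) 1 (volOn Ω) ≤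
      ENNReal.ofReal ρ.rOut * eLpNorm (gradient φ) 1 (volOn Ω) := by
  have hgrad : eLpNorm (gradient φ) 1 (volOn Ω) = ∫⁻ x, ‖fderiv ℝ φ x‖ₑ := by
    rw [eLpNorm_restrict_eq_of_support_subset fun x => not_imp_comm.1
      (gradient_testFunction_eq_zero_of_notMem φ), eLpNorm_one_eq_lintegral_enorm]
    refine lintegral_congr fun x => ?_
    rw [← ofReal_norm, ← ofReal_norm, norm_gradient_eq_norm_fderiv]
  rw [hgrad, eLpNorm_one_eq_lintegral_enorm]
  simp only [mollify_testFunction]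
  exact (setLIntegral_le_lintegral _ _).trans
    (lintegral_enorm_normed_convolution_sub_le ρ (φ.contDiff.of_le (by simp)))

theorem MemW10.eLpNorm_mollify_sub_le (hΩ : Bornology.IsBounded (Ω : Set Plane)) {u : Plane → ℝ}
    {U : Plane → Plane} (hu : MemW10 Ω 1 u U) :
    eLpNorm (fun x => mollify Ω ρ u x - u x) 1 (volOn Ω) ≤
      ENNReal.ofReal ρ.rOut * eLpNorm U 1 (volOn Ω) := by
  refine hu.eLpNorm_map_le le_rfl (T := fun v x => mollify Ω ρ v x - v x)
    (C := ρ.rOut.toNNReal)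
    (fun φ => ?_) eLpNorm_mollify_testFunction_sub_le fun φ hae hφ => ?_
  · have hφ : MemLp φ 1 (volOn Ω) := memLp_testFunction φ 1
    exact (continuous_mollify (memLp_one_iff_integrable.1 hφ)).aestronglyMeasurable.sub hφ.1
  · filter_upwards [hae] with x hx
    refine .sub ?_ hx
    have := tendsto_integral_inner (memLp_normed_sub (ρ := ρ) hΩ x ∞)
      (fun n => memLp_testFunction (φ n) 1) hu.1.1 hφ
    simpa [mollify, mul_comm] using this

theorem exists_tendsto_eLpNorm_sub_of_cauchySeq {α E : Type*} [MeasurableSpace α]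
    {μ : Measure α} [NormedAddCommGroup E] [CompleteSpace E] {p : ℝ≥0∞} [Fact (1 ≤ p)]
    {f : ℕ → α → E} (hf : ∀ n, MemLp (f n) p μ) (h : CauchySeq fun n => (hf n).toLp (f n)) :
    ∃ g, MemLp g p μ ∧ Tendsto (fun n => eLpNorm (fun x => f n x - g x) p μ) atTop (𝓝 0) := by
  obtain ⟨g, hg⟩ := cauchySeq_tendsto_of_complete h
  refine ⟨g, Lp.memLp g, ?_⟩
  rw [← Lp.toLp_coeFn g (Lp.memLp g)] at hg
  exact (Lp.tendsto_Lp_iff_tendsto_eLpNorm'' f hf g (Lp.memLp g)).1 hg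

theorem MemW10.cauchySeq_toLp (hΩ : Bornology.IsBounded (Ω : Set Plane)) {u : ℕ → Plane → ℝ}
    {f₀ : Plane → ℝ} {U : ℕ → Plane → Plane} {A : ℝ} {B : ℝ≥0} (hu : ∀ n, MemW10 Ω 1 (u n) (U n))
    (hf₀ : Integrable f₀ (volOn Ω)) (hA : ∀ n, ∫ x in (Ω : Set Plane), ‖u n x‖ ≤ A)
    (hB : ∀ n, eLpNorm (U n) 1 (volOn Ω) ≤ B)
    (hlim : ∀ h, MemLp h 2 (volOn Ω) → Tendsto (fun n => ∫ x in (Ω : Set Plane), h x * u n x)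
      atTop (𝓝 (∫ x in (Ω : Set Plane), h x * f₀ x))) :
    CauchySeq fun n => (hu n).1.1.toLp (u n) := by
  refine cauchySeq_of_forall_exists_edist_le fun ε hε => ?_
  obtain ⟨δ, hδ, hδε⟩ := ENNReal.exists_nnreal_pos_mul_lt (ENNReal.coe_ne_top (r := B)) hε.ne'
  let ρ : ContDiffBump (0 : Plane) := ⟨δ / 2, δ, by positivity, half_lt_self (by positivity)⟩
  have hint (n : ℕ) : Integrable (u n) (volOn Ω) := memLp_one_iff_integrable.1 (hu n).1.1
  have hsub (n : ℕ) : eLpNorm (fun x => mollify Ω ρ (u n) x - u n x) 1 (volOn Ω) ≤ ε := by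
    refine ((hu n).eLpNorm_mollify_sub_le hΩ).trans (le_trans ?_ hδε.le)
    rw [ENNReal.ofReal_coe_nnreal]
    gcongr
    exact hB n
  have hM (n : ℕ) : MemLp (mollify Ω ρ (u n)) 1 (volOn Ω) := memLp_mollify hΩ (hint n) 1
  refine ⟨fun n => (hM n).toLp _, (((Lp.tendsto_Lp_iff_tendsto_eLpNorm'' _ hM _
    (memLp_mollify hΩ hf₀ 1)).2 (tendsto_eLpNorm_mollify_sub hΩ hint hf₀ hA hlim)).cauchySeq),
    fun n => ?_⟩
  rw [edist_comm, Lp.edist_toLp_toLp]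
  exact hsub n

theorem MemW10.exists_subseq_tendsto_eLpNorm_one (hΩ : Bornology.IsBounded (Ω : Set Plane))
    {u : ℕ → Plane → ℝ} {U : ℕ → Plane → Plane} {A B : ℝ≥0} (hu : ∀ n, MemW10 Ω 1 (u n) (U n))
    (hA : ∀ n, eLpNorm (u n) 2 (volOn Ω) ≤ A) (hB : ∀ n, eLpNorm (U n) 1 (volOn Ω) ≤ B) :
    ∃ (s : ℕ → ℕ) (w : Plane → ℝ), StrictMono s ∧ MemLp w 1 (volOn Ω) ∧
      Tendsto (fun n => eLpNorm (fun x => u (s n) x - w x) 1 (volOn Ω)) atTop (𝓝 0) := by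
  have := isFiniteMeasure_volOn hΩ
  have hu2 (n : ℕ) : MemLp (u n) 2 (volOn Ω) :=
    ⟨(hu n).1.1.1, (hA n).trans_lt ENNReal.coe_lt_top⟩
  obtain ⟨s, f₀, hs, hf₀, hlim⟩ := exists_subseq_tendsto_integral_mul hu2 hA
  obtain ⟨c, hc⟩ := exists_eLpNorm_le_mul_eLpNorm_of_exponent_le (E := ℝ) (μ := volOn Ω)
    one_ne_zero one_le_two
  have hA1 (n : ℕ) : ∫ x in (Ω : Set Plane), ‖u n x‖ ≤ c * A := by
    rw [integral_norm_eq_lintegral_enorm (hu2 n).1, ← eLpNorm_one_eq_lintegral_enorm]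
    rw [← NNReal.coe_mul]
    refine ENNReal.toReal_le_coe_of_le_coe ?_
    push_cast
    exact (hc _ (hu2 n).1).trans (by gcongr; exact hA n)
  obtain ⟨w, hw⟩ := exists_tendsto_eLpNorm_sub_of_cauchySeq _ <| MemW10.cauchySeq_toLp hΩ
    (fun n => hu (s n)) (hf₀.integrable one_le_two) (fun n => hA1 (s n)) (fun n => hB (s n)) hlim
  exact ⟨s, w, hs, hw⟩

end Rellich

section Compactness

variable {Ω : Opens Plane}

theorem MemW10.mono_exponent [IsFiniteMeasure (volOn Ω)] {p q : ℝ≥0∞} (hq : 1 ≤ q) (hqp : q ≤ p)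
    {u : Plane → ℝ} {U : Plane → Plane} (hu : MemW10 Ω p u U) : MemW10 Ω q u U := by
  obtain ⟨⟨hu, hU, -⟩, φ, hφ, hdφ⟩ := hu
  refine .of_tendsto hq (hu.mono_exponent hqp) (hU.mono_exponent hqp) φ
    (tendsto_eLpNorm_of_exponent_le (zero_lt_one.trans_le hq).ne' hqp
      (fun n => ((memLp_testFunction (φ n) p).sub hu).1) hφ)
    (tendsto_eLpNorm_of_exponent_le (zero_lt_one.trans_le hq).ne' hqp
      (fun n => ((memLp_gradient_testFunction (φ n) p).sub hU).1) hdφ)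

theorem MemW10.exists_subseq_tendsto_eLpNorm (hΩ : Bornology.IsBounded (Ω : Set Plane))
    {u : ℕ → Plane → ℝ} {U : ℕ → Plane → Plane} {r : ℝ≥0∞} {A B : ℝ≥0} (hr : 2 ≤ r)
    (hu : ∀ n, MemW10 Ω 1 (u n) (U n)) (hA : ∀ n, eLpNorm (u n) r (volOn Ω) ≤ A)
    (hB : ∀ n, eLpNorm (U n) 1 (volOn Ω) ≤ B) :
    ∃ (s : ℕ → ℕ) (w : Plane → ℝ), StrictMono s ∧ ∀ q, 1 ≤ q → q < r → MemLp w q (volOn Ω) ∧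
      Tendsto (fun n => eLpNorm (fun x => u (s n) x - w x) q (volOn Ω)) atTop (𝓝 0) := by
  have := isFiniteMeasure_volOn hΩ
  have hm (n : ℕ) : AEStronglyMeasurable (u n) (volOn Ω) := (hu n).1.1.1
  obtain ⟨c, hc⟩ := exists_eLpNorm_le_mul_eLpNorm_of_exponent_le (E := ℝ) (μ := volOn Ω)
    two_ne_zero hr
  have hA2 (n : ℕ) : eLpNorm (u n) 2 (volOn Ω) ≤ (c * A : ℝ≥0) := by
    push_cast
    exact (hc _ (hm n)).trans (by gcongr; exact hA n)
  obtain ⟨s, w, hs, hw, hlim⟩ := MemW10.exists_subseq_tendsto_eLpNorm_one hΩ hu hA2 hB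
  exact ⟨s, w, hs, fun q hq hqr => tendsto_eLpNorm_sub_of_tendstoInMeasure hq hqr
    (fun n => hm (s n)) (fun n => hA (s n))
    (tendstoInMeasure_of_tendsto_eLpNorm one_ne_zero (fun n => hm (s n)) hw.1 hlim)⟩

theorem exists_eLpNorm_four_le_of_hasWeakNegDiv (hΩ : Bornology.IsBounded (Ω : Set Plane))
    (D : ℝ≥0) : ∃ K : ℝ≥0, ∀ (u g : Plane → ℝ) (U : Plane → Plane), MemW10 Ω 2 u U →
      HasWeakNegDiv Ω U g → Integrable g (volOn Ω) → eLpNorm g 1 (volOn Ω) ≤ D →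
      eLpNorm u 4 (volOn Ω) ≤ K := by
  have := isFiniteMeasure_volOn hΩ
  have hp1 : (1 : ℝ≥0) ≤ 4 / 3 := by rw [← NNReal.coe_le_coe]; norm_num
  have hp2 : (4 / 3 : ℝ≥0) < 2 := by rw [← NNReal.coe_lt_coe]; norm_num
  obtain ⟨C, hC⟩ := exists_eLpNorm_testFunction_le_of_lt_two hΩ (q := 4) hp1 hp2
    (by push_cast; norm_num)
  obtain ⟨K, hK⟩ := exists_eLpNorm_le_of_hasWeakNegDiv hΩ (q := (4 / 3 : ℝ≥0)) (mod_cast hp1)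
    (mod_cast hp2) D
  refine ⟨C * K, fun u g U hu h hg hD => ?_⟩
  push_cast
  exact ((hu.mono_exponent (mod_cast hp1) (mod_cast hp2.le)).eLpNorm_le (mod_cast hp1) hC).trans
    (by gcongr; exact hK u g U hu h hg hD)

theorem eLpNorm_sqrt_one_add_sq_div_le {α : Type*} [MeasurableSpace α] {μ : Measure α} {p : ℝ≥0∞}
    (hp : 1 ≤ p) {w : α → ℝ} (hw : AEStronglyMeasurable w μ) {δ : ℝ≥0} (hδ : 0 < δ)
    (hwδ : eLpNorm w p μ ≤ δ) :
    eLpNorm (fun x => √(1 + (w x / δ) ^ 2)) p μ ≤ eLpNorm (fun _ => (1 : ℝ)) p μ + 1 := by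
  have hle (t : ℝ) : ‖√(1 + (t / δ) ^ 2)‖ ≤ 1 + ‖t / δ‖ := by
    rw [Real.norm_of_nonneg (Real.sqrt_nonneg _), Real.norm_eq_abs]
    refine Real.sqrt_le_iff.2 ⟨by positivity, ?_⟩
    rw [← sq_abs (t / δ)]
    linarith [add_sq 1 |t / (δ : ℝ)|, abs_nonneg (t / (δ : ℝ))]
  have hscale : eLpNorm (fun x => w x / δ) p μ ≤ 1 := by
    simp only [div_eq_inv_mul, ← smul_eq_mul]
    refine (eLpNorm_const_smul_le (c := (δ : ℝ)⁻¹) (f := w)).trans ?_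
    rw [enorm_inv (by positivity), Real.enorm_of_nonneg δ.coe_nonneg,
      ENNReal.ofReal_coe_nnreal]
    exact (mul_le_mul_right hwδ _).trans_eq
      (ENNReal.inv_mul_cancel (by positivity) ENNReal.coe_ne_top)
  refine (eLpNorm_mono_real fun x => hle (w x)).trans ((eLpNorm_add_le aestronglyMeasurable_const
    (hw.aemeasurable.div_const _).aestronglyMeasurable.norm hp).trans ?_)
  rw [eLpNorm_norm]
  gcongr

-- Test with `ψ(w)` for `ψ(t) = δ arctan(t / δ)`, which is of size `δ` with `ψ' = (1 + (t/δ)²)⁻¹`.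
theorem HasWeakNegDiv.eLpNorm_one_le {g w : Plane → ℝ} {W : Plane → Plane}
    (h : HasWeakNegDiv Ω W g) (hg : Integrable g (volOn Ω)) (hw : MemW10 Ω 2 w W) {δ : ℝ≥0}
    (hδ : 0 < δ) (hwδ : eLpNorm w 2 (volOn Ω) ≤ δ) :
    eLpNorm W 1 (volOn Ω) ≤ (eLpNorm (fun _ => (1 : ℝ)) 2 (volOn Ω) + 1) *
      (ENNReal.ofReal (δ * (Real.pi / 2)) * eLpNorm g 1 (volOn Ω)) ^ (2⁻¹ : ℝ) := by
  have hpos (t : ℝ) : 0 < 1 + (t / δ) ^ 2 := by positivity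
  have hderiv (t : ℝ) : deriv (fun t => δ * Real.arctan (t / δ)) t = (1 + (t / δ) ^ 2)⁻¹ := by
    refine ((((hasDerivAt_id t).div_const (δ : ℝ)).arctan).const_mul (δ : ℝ)).deriv.trans ?_
    simp only [id]
    field_simp
  have hsqrt : Continuous fun t : ℝ => √(1 + (t / δ) ^ 2) := by fun_prop
  have hweight : eLpNorm (fun x => (√(1 + (w x / δ) ^ 2))⁻¹⁻¹) 2 (volOn Ω) ≤
      eLpNorm (fun _ => (1 : ℝ)) 2 (volOn Ω) + 1 := by
    simpa only [inv_inv] using eLpNorm_sqrt_one_add_sq_div_le one_le_two hw.1.1.1 hδ hwδ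
  refine (h.eLpNorm_le hg hw (ψ := fun t => δ * Real.arctan (t / δ))
    (χ := fun t => (√(1 + (t / δ) ^ 2))⁻¹) (M := 1) (B := δ * (Real.pi / 2))
    (contDiff_const.mul (Real.contDiff_arctan.comp (contDiff_id.div_const _))) (by simp)
    (fun t => ?_) (fun t => ?_) (hsqrt.inv₀ fun t => (Real.sqrt_pos.2 (hpos t)).ne')
    (fun t => (inv_pos.2 (Real.sqrt_pos.2 (hpos t))).ne') (fun t => ?_) 2 1).trans (by gcongr)
  · rw [hderiv, abs_of_pos (inv_pos.2 (hpos t))]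
    exact inv_le_one_of_one_le₀ (by nlinarith [sq_nonneg (t / δ)])
  · rw [abs_mul, NNReal.abs_eq]
    gcongr
    exact abs_le.2 ⟨(Real.neg_pi_div_two_lt_arctan _).le, (Real.arctan_lt_pi_div_two _).le⟩
  · rw [hderiv, inv_pow, Real.sq_sqrt (hpos t).le]

theorem exists_eLpNorm_one_le_of_hasWeakNegDiv (hΩ : Bornology.IsBounded (Ω : Set Plane))
    (D : ℝ≥0) {ε : ℝ≥0∞} (hε : 0 < ε) : ∃ δ : ℝ≥0, 0 < δ ∧
      ∀ (w g : Plane → ℝ) (W : Plane → Plane), MemW10 Ω 2 w W → HasWeakNegDiv Ω W g →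
      Integrable g (volOn Ω) → eLpNorm g 1 (volOn Ω) ≤ D → eLpNorm w 2 (volOn Ω) ≤ δ →
      eLpNorm W 1 (volOn Ω) ≤ ε := by
  have := isFiniteMeasure_volOn hΩ
  set S : ℝ≥0∞ := eLpNorm (fun _ => (1 : ℝ)) 2 (volOn Ω) + 1
  have hS : S ≠ ∞ := ENNReal.add_ne_top.2 ⟨(memLp_const _).2.ne, ENNReal.one_ne_top⟩
  obtain ⟨δ, hδ, hδε⟩ : ∃ δ : ℝ≥0, 0 < δ ∧
      S * (ENNReal.ofReal (δ * (Real.pi / 2)) * D) ^ (2⁻¹ : ℝ) ≤ ε := by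
    have hlim : Tendsto (fun δ : ℝ≥0 => S * (ENNReal.ofReal (δ * (Real.pi / 2)) * D) ^ (2⁻¹ : ℝ))
        (𝓝[>] 0) (𝓝 0) := by
      have hcont : Continuous fun δ : ℝ≥0 =>
          S * (ENNReal.ofReal (δ * (Real.pi / 2)) * D) ^ (2⁻¹ : ℝ) :=
        (ENNReal.continuous_const_mul hS).comp <| (ENNReal.continuous_rpow_const).comp <|
          (ENNReal.continuous_mul_const ENNReal.coe_ne_top).comp <|
            ENNReal.continuous_ofReal.comp (by fun_prop)
      simpa using (hcont.tendsto 0).mono_left nhdsWithin_le_nhds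
    exact ((hlim.eventually (ge_mem_nhds hε)).and self_mem_nhdsWithin).exists.imp fun _ => And.symm
  refine ⟨δ, hδ, fun w g W hw h hg hD hwδ => (h.eLpNorm_one_le hg hw hδ hwδ).trans ?_⟩
  exact le_trans (by gcongr) hδε

theorem cauchySeq_toLp_of_hasWeakNegDiv (hΩ : Bornology.IsBounded (Ω : Set Plane))
    {u g : ℕ → Plane → ℝ} {U : ℕ → Plane → Plane} (hu : ∀ n, MemW10 Ω 2 (u n) (U n))
    (hU : ∀ n, MemLp (U n) 1 (volOn Ω)) (h : ∀ n, HasWeakNegDiv Ω (U n) (g n))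
    (hg : ∀ n, Integrable (g n) (volOn Ω)) {D : ℝ≥0} (hD : ∀ n, eLpNorm (g n) 1 (volOn Ω) ≤ D)
    (hC : CauchySeq fun n => (hu n).1.1.toLp (u n)) :
    CauchySeq fun n => (hU n).toLp (U n) := by
  refine EMetric.cauchySeq_iff.2 fun ε hε => ?_
  obtain ⟨ε', hε', hεε'⟩ := exists_between hε
  obtain ⟨δ, hδ, hle⟩ := exists_eLpNorm_one_le_of_hasWeakNegDiv hΩ (D + D) hε'
  obtain ⟨N, hN⟩ := EMetric.cauchySeq_iff.1 hC δ (ENNReal.coe_pos.2 hδ)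
  refine ⟨N, fun m hm n hn => lt_of_le_of_lt ?_ hεε'⟩
  have hmn := hN m hm n hn
  rw [Lp.edist_toLp_toLp] at hmn ⊢
  refine hle _ _ _ ((hu m).sub one_le_two (hu n))
    ((h m).sub one_le_two (h n) (hu m).1.2.1 (hu n).1.2.1 (hg m) (hg n)) ((hg m).sub (hg n)) ?_
    hmn.le
  push_cast
  exact (eLpNorm_sub_le (hg m).1 (hg n).1 le_rfl).trans (add_le_add (hD m) (hD n))

theorem exists_tendsto_eLpNorm_of_hasWeakNegDiv (hΩ : Bornology.IsBounded (Ω : Set Plane))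
    {u g : ℕ → Plane → ℝ} {U : ℕ → Plane → Plane} (hu : ∀ n, MemW10 Ω 2 (u n) (U n))
    (h : ∀ n, HasWeakNegDiv Ω (U n) (g n)) (hg : ∀ n, Integrable (g n) (volOn Ω)) {D : ℝ≥0}
    (hD : ∀ n, eLpNorm (g n) 1 (volOn Ω) ≤ D) (hC : CauchySeq fun n => (hu n).1.1.toLp (u n)) :
    ∃ G : Plane → Plane, ∀ q, 1 ≤ q → q < 2 → MemLp G q (volOn Ω) ∧
      Tendsto (fun n => eLpNorm (fun x => U n x - G x) q (volOn Ω)) atTop (𝓝 0) := by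
  have := isFiniteMeasure_volOn hΩ
  have hm (n : ℕ) : AEStronglyMeasurable (U n) (volOn Ω) := (hu n).1.2.1.1
  obtain ⟨G, hG, hlim⟩ := exists_tendsto_eLpNorm_sub_of_cauchySeq _
    (cauchySeq_toLp_of_hasWeakNegDiv hΩ hu (fun n => (hu n).1.2.1.mono_exponent one_le_two) h hg hD
      hC)
  refine ⟨G, fun q hq hq2 => ?_⟩
  obtain ⟨r, hqr, hr2⟩ := exists_between hq2
  obtain ⟨K, hK⟩ := exists_eLpNorm_le_of_hasWeakNegDiv hΩ (hq.trans hqr.le) hr2 D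
  exact tendsto_eLpNorm_sub_of_tendstoInMeasure hq hqr hm
    (fun n => hK _ _ _ (hu n) (h n) (hg n) (hD n))
    (tendstoInMeasure_of_tendsto_eLpNorm one_ne_zero hm hG.1 hlim)

theorem exists_subseq_tendsto_of_hasWeakNegDiv (hΩ : Bornology.IsBounded (Ω : Set Plane))
    {u g : ℕ → Plane → ℝ} {U : ℕ → Plane → Plane} (hu : ∀ n, MemW10 Ω 2 (u n) (U n))
    (h : ∀ n, HasWeakNegDiv Ω (U n) (g n)) (hg : ∀ n, Integrable (g n) (volOn Ω)) {D : ℝ≥0}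
    (hD : ∀ n, eLpNorm (g n) 1 (volOn Ω) ≤ D) :
    ∃ (s : ℕ → ℕ) (w : Plane → ℝ) (G : Plane → Plane), StrictMono s ∧
      ∀ q : ℝ≥0∞, 1 ≤ q → q < 2 → MemW10 Ω q w G ∧
        Tendsto (fun n => eLpNorm (fun x => u (s n) x - w x) q (volOn Ω)) atTop (𝓝 0) ∧
        Tendsto (fun n => eLpNorm (fun x => U (s n) x - G x) q (volOn Ω)) atTop (𝓝 0) := by
  have := isFiniteMeasure_volOn hΩ
  obtain ⟨A, hA⟩ := exists_eLpNorm_four_le_of_hasWeakNegDiv hΩ D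
  obtain ⟨B, hB⟩ := exists_eLpNorm_le_of_hasWeakNegDiv hΩ le_rfl ENNReal.one_lt_two D
  obtain ⟨s, w, hs, hw⟩ := MemW10.exists_subseq_tendsto_eLpNorm hΩ (r := 4) (by norm_num)
    (fun n => (hu n).mono_exponent le_rfl one_le_two)
    (fun n => hA _ _ _ (hu n) (h n) (hg n) (hD n)) (fun n => hB _ _ _ (hu n) (h n) (hg n) (hD n))
  obtain ⟨hw2, hlim2⟩ := hw 2 one_le_two (by norm_num)
  obtain ⟨G, hG⟩ := exists_tendsto_eLpNorm_of_hasWeakNegDiv hΩ (fun n => hu (s n))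
    (fun n => h (s n)) (fun n => hg (s n)) (fun n => hD (s n))
    ((Lp.tendsto_Lp_iff_tendsto_eLpNorm'' _ _ w hw2).2 hlim2).cauchySeq
  refine ⟨s, w, G, hs, fun q hq hq2 => ?_⟩
  obtain ⟨hwq, hlimw⟩ := hw q hq (hq2.trans (by norm_num))
  obtain ⟨hGq, hlimG⟩ := hG q hq hq2
  exact ⟨.of_tendsto_memW10 hq hwq hGq (fun n => (hu (s n)).mono_exponent hq hq2.le) hlimw hlimG,
    hlimw, hlimG⟩

end Compactness

section EnergyClass

/-- `u ∈ W_0^{1,2}(Ω)` with weak gradient `U` and distributional Laplacian `L ∈ L¹(Ω)`: the finite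
energy solutions of the Dirichlet problem with integrable right-hand side. -/
def EnergyClass (Ω : Opens Plane) (u : Plane → ℝ) (U : Plane → Plane) (L : Plane → ℝ) : Prop :=
  MemW10 Ω 2 u U ∧ HasWeakLaplacian Ω u L ∧ Integrable L (volOn Ω)

variable {Ω : Opens Plane} {u L : Plane → ℝ} {U : Plane → Plane}

theorem EnergyClass.hasWeakNegDiv (hu : EnergyClass Ω u U L) :
    HasWeakNegDiv Ω U (fun x => -L x) :=
  hu.2.1.hasWeakNegDiv hu.1.1.2.2

theorem EnergyClass.exists_eLpNorm_le (hΩ : Bornology.IsBounded (Ω : Set Plane)) {q : ℝ≥0∞}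
    (hq1 : 1 ≤ q) (hq2 : q < 2) (C : ℝ≥0) : ∃ Cq : ℝ≥0, ∀ (u : Plane → ℝ) (U : Plane → Plane)
      (L : Plane → ℝ), EnergyClass Ω u U L → eLpNorm L 1 (volOn Ω) ≤ C →
        eLpNorm U q (volOn Ω) ≤ Cq := by
  obtain ⟨K, hK⟩ := exists_eLpNorm_le_of_hasWeakNegDiv hΩ hq1 hq2 C
  exact ⟨K, fun u U L hu hC => hK u _ U hu.1 hu.hasWeakNegDiv hu.2.2.neg
    ((eLpNorm_neg L 1 _).trans_le hC)⟩

theorem EnergyClass.integral_inner_eq_neg_integral_mul (hu : EnergyClass Ω u U L) {z : Plane → ℝ}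
    {Z : Plane → Plane} (hz : MemW10 Ω 2 z Z) (hz_top : eLpNorm z ∞ (volOn Ω) ≠ ∞) :
    ∫ x in (Ω : Set Plane), inner ℝ (Z x) (U x) = -∫ x in (Ω : Set Plane), z x * L x := by
  have hbound : ∀ᵐ x ∂volOn Ω, |z x| ≤ (eLpNorm z ∞ (volOn Ω)).toReal := by
    rw [eLpNorm_exponent_top] at hz_top ⊢
    filter_upwards [ae_le_eLpNormEssSup (f := z) (μ := volOn Ω)] with x hx
    simpa using ENNReal.toReal_mono hz_top hx
  calc ∫ x in (Ω : Set Plane), inner ℝ (Z x) (U x)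
      = ∫ x in (Ω : Set Plane), inner ℝ (U x) (Z x) := by simp only [real_inner_comm]
    _ = ∫ x in (Ω : Set Plane), -L x * z x :=
        hu.hasWeakNegDiv.integral_inner_of_ae_abs_le hu.1.1.2.1 hu.2.2.neg ENNReal.ofNat_ne_top hz
          hbound
    _ = -∫ x in (Ω : Set Plane), z x * L x := by
        rw [← integral_neg]
        simp only [neg_mul, mul_comm (z _)]

theorem DirichletClass.energyClass (hΩ : Bornology.IsBounded (Ω : Set Plane)) {k : ℝ≥0∞}
    {ε : ℝ≥0} (hk : 1 ≤ k) (hε : 0 < ε) (hu : DirichletClass Ω k ε u)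
    (hL : HasWeakLaplacian Ω u L) : EnergyClass Ω u (gradient u) L :=
  have := isFiniteMeasure_volOn hΩ
  ⟨hu.memW10 hΩ one_le_two ENNReal.ofNat_ne_top hε, hL, hu.1.integrable_laplacian hk hL⟩

theorem IsBrezisMerleSolution.eLpNorm_laplacian_le {k : ℝ≥0∞} {ε b C : ℝ≥0} {V : Plane → ℝ}
    (h : IsBrezisMerleSolution Ω k ε b C V u) :
    eLpNorm (fun x => -(V x * Real.exp (u x))) 1 (volOn Ω) ≤ (b * C : ℝ≥0) := by
  obtain ⟨-, -, hV, -, hexp⟩ := h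
  calc eLpNorm (fun x => -(V x * Real.exp (u x))) 1 (volOn Ω)
      ≤ ∫⁻ x in (Ω : Set Plane), (b : ℝ≥0∞) * ENNReal.ofReal (Real.exp (u x)) := by
        rw [eLpNorm_one_eq_lintegral_enorm]
        refine lintegral_mono_ae (hV.mono fun x hx => ?_)
        rw [enorm_neg, enorm_mul, Real.enorm_of_nonneg hx.1,
          Real.enorm_of_nonneg (Real.exp_nonneg _)]
        gcongr
        exact (ENNReal.ofReal_le_ofReal hx.2).trans_eq ENNReal.ofReal_coe_nnreal
    _ = b * ∫⁻ x in (Ω : Set Plane), ENNReal.ofReal (Real.exp (u x)) :=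
        lintegral_const_mul' _ _ ENNReal.coe_ne_top
    _ ≤ (b * C : ℝ≥0) := by
        push_cast
        gcongr

end EnergyClass

theorem mainTheorem7_general (Ω : Opens Plane) (hΩ : Bornology.IsBounded (Ω : Set Plane)) :
    (∀ q : ℝ≥0∞, 1 ≤ q → q < 2 → ∀ C : ℝ≥0, ∃ Cq : ℝ≥0,
      ∀ (u : Plane → ℝ) (U : Plane → Plane) (L : Plane → ℝ), EnergyClass Ω u U L →
        eLpNorm L 1 (volOn Ω) ≤ C → eLpNorm U q (volOn Ω) ≤ Cq) ∧
    (∀ p : ℝ≥0∞, 2 < p → ∃ K : ℝ≥0, ∀ f : Plane → Plane, MemLp f p (volOn Ω) →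
      (∃ (z : Plane → ℝ) (Z : Plane → Plane), IsDivSolution Ω f z Z) ∧
      ∀ (z : Plane → ℝ) (Z : Plane → Plane), IsDivSolution Ω f z Z →
        eLpNorm z ∞ (volOn Ω) ≤ K * eLpNorm f p (volOn Ω) ∧
        ∀ (u : Plane → ℝ) (U : Plane → Plane) (L : Plane → ℝ), EnergyClass Ω u U L →
          ∫ x in (Ω : Set Plane), inner ℝ (f x) (U x) =
            -∫ x in (Ω : Set Plane), inner ℝ (Z x) (U x) ∧
          ∫ x in (Ω : Set Plane), inner ℝ (f x) (U x) =
            ∫ x in (Ω : Set Plane), z x * L x) ∧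
    (∀ (C : ℝ≥0) (u : ℕ → Plane → ℝ) (U : ℕ → Plane → Plane) (L : ℕ → Plane → ℝ),
      (∀ i, EnergyClass Ω (u i) (U i) (L i)) → (∀ i, eLpNorm (L i) 1 (volOn Ω) ≤ C) →
        (∀ q : ℝ≥0∞, 1 ≤ q → q < 2 → ∀ G : Plane → Plane, AEStronglyMeasurable G (volOn Ω) →
          (∀ S : Set Plane, IsCompact S → S ⊆ Ω →
            Tendsto (fun i => eLpNorm (fun x => U i x - G x) q (volume.restrict S))
              atTop (𝓝 0)) →
          Tendsto (fun i => eLpNorm (fun x => U i x - G x) q (volOn Ω)) atTop (𝓝 0)) ∧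
        (∃ (s : ℕ → ℕ) (w : Plane → ℝ) (G : Plane → Plane), StrictMono s ∧
          ∀ q : ℝ≥0∞, 1 ≤ q → q < 2 → MemW10 Ω q w G ∧
            Tendsto (fun i => eLpNorm (fun x => u (s i) x - w x) q (volOn Ω)) atTop (𝓝 0) ∧
            Tendsto (fun i => eLpNorm (fun x => U (s i) x - G x) q (volOn Ω)) atTop (𝓝 0))) := by
  have := isFiniteMeasure_volOn hΩ
  refine ⟨fun q hq1 hq2 C => EnergyClass.exists_eLpNorm_le hΩ hq1 hq2 C, fun p hp => ?_,
    fun C u U L hu hC => ⟨fun q hq1 hq2 G hG hS => ?_, ?_⟩⟩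
  · obtain ⟨K, hK⟩ := exists_eLpNorm_top_le_of_isDivSolution hΩ hp
    refine ⟨K, fun f hf => ⟨?_, fun z Z hz => ⟨hK f hf z Z hz, fun u U L hu => ?_⟩⟩⟩
    · simp only [isDivSolution_iff_hasWeakNegDiv_add (hf.mono_exponent hp.le)]
      exact exists_memW10_hasWeakNegDiv_add hΩ MemLp.zero (hf.mono_exponent hp.le)
    have hz_top : eLpNorm z ∞ (volOn Ω) ≠ ∞ :=
      ((hK f hf z Z hz).trans_lt (ENNReal.mul_lt_top ENNReal.coe_lt_top hf.2)).ne
    have hfU := hz.integral_inner (hf.mono_exponent hp.le) hu.1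
    exact ⟨hfU, by rw [hfU, hu.integral_inner_eq_neg_integral_mul hz.1 hz_top, neg_neg]⟩
  · obtain ⟨r, hqr, hr2⟩ := exists_between hq2
    obtain ⟨K, hK⟩ := EnergyClass.exists_eLpNorm_le hΩ (hq1.trans hqr.le) hr2 C
    exact tendsto_eLpNorm_sub_of_forall_isCompact hΩ (fun i => (hu i).1.1.2.1.1) hG hq1 hqr
      (fun i => hK _ _ _ (hu i) (hC i)) hS
  · exact exists_subseq_tendsto_of_hasWeakNegDiv hΩ (fun i => (hu i).1)
      (fun i => (hu i).hasWeakNegDiv) (fun i => (hu i).2.2.neg)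
      fun i => (eLpNorm_neg _ 1 _).trans_le (hC i)

theorem mainTheorem7 (Ω : TopologicalSpace.Opens Plane)
    (hΩ : Bornology.IsBounded (Ω : Set Plane)) :
    -- uniform gradient bound
    (∀ q : ℝ≥0∞, 1 ≤ q → q < 2 → ∀ C : ℝ≥0, ∃ Cq : ℝ≥0,
      ∀ (k : ℝ≥0∞) (ε : ℝ≥0), 1 ≤ k → 0 < ε → ε ≤ 1 →
      ∀ u L : Plane → ℝ, DirichletClass Ω k ε u → HasWeakLaplacian Ω u L →
        eLpNorm L 1 (volOn Ω) ≤ C →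
        eLpNorm (gradient u) q (volOn Ω) ≤ Cq) ∧
    -- the dual problem `-Δz = div f`: solvability, sup bound and duality identity
    (∀ p : ℝ≥0∞, 2 < p → ∃ K : ℝ≥0,
      ∀ f : Plane → Plane, MemLp f p (volOn Ω) →
        (∃ (z : Plane → ℝ) (Z : Plane → Plane), IsDivSolution Ω f z Z) ∧
        ∀ (z : Plane → ℝ) (Z : Plane → Plane), IsDivSolution Ω f z Z →
          eLpNorm z ∞ (volOn Ω) ≤ K * eLpNorm f p (volOn Ω) ∧
          ∀ (k : ℝ≥0∞) (ε : ℝ≥0), 1 ≤ k → 0 < ε → ε ≤ 1 →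
          ∀ u L : Plane → ℝ, DirichletClass Ω k ε u → HasWeakLaplacian Ω u L →
            ∫ x in (Ω : Set Plane), inner ℝ (f x) (gradient u x) =
              - ∫ x in (Ω : Set Plane), inner ℝ (Z x) (gradient u x) ∧
            ∫ x in (Ω : Set Plane), inner ℝ (f x) (gradient u x) =
              ∫ x in (Ω : Set Plane), z x * L x) ∧
    -- the Brezis-Merle setting
    (∀ (k : ℝ≥0∞) (ε : ℝ≥0), 1 ≤ k → 0 < ε → ε ≤ 1 →
      ∀ (b C : ℝ≥0) (V u : ℕ → Plane → ℝ),
      (∀ i, IsBrezisMerleSolution Ω k ε b C (V i) (u i)) →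
        -- interior convergence of the gradients implies global convergence
        (∀ q : ℝ≥0∞, 1 ≤ q → q < 2 →
          ∀ (w : Plane → ℝ) (G : Plane → Plane), HasWeakGradient Ω w G →
          (∀ S : Set Plane, IsCompact S → S ⊆ Ω →
            Tendsto (fun i => eLpNorm (fun x => gradient (u i) x - G x) q (volume.restrict S))
              atTop (𝓝 0)) →
          Tendsto (fun i => eLpNorm (fun x => gradient (u i) x - G x) q (volOn Ω))
            atTop (𝓝 0)) ∧
        -- and along a subsequence there is such a limit
        (∃ (s : ℕ → ℕ) (w : Plane → ℝ) (G : Plane → Plane), StrictMono s ∧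
          ∀ q : ℝ≥0∞, 1 ≤ q → q < 2 →
            MemW10 Ω q w G ∧
            Tendsto (fun i => eLpNorm (fun x => u (s i) x - w x) q (volOn Ω)) atTop (𝓝 0) ∧
            Tendsto (fun i => eLpNorm (fun x => gradient (u (s i)) x - G x) q (volOn Ω))
              atTop (𝓝 0))) := by
  obtain ⟨hgrad, hdual, hseq⟩ := mainTheorem7_general Ω hΩ
  refine ⟨fun q hq1 hq2 C => ?_, fun p hp => ?_, fun k ε hk hε _ b C V u h => ?_⟩
  · obtain ⟨Cq, hCq⟩ := hgrad q hq1 hq2 C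
    exact ⟨Cq, fun k ε hk hε _ u L hu hL => hCq u _ L (hu.energyClass hΩ hk hε hL)⟩
  · obtain ⟨K, hK⟩ := hdual p hp
    refine ⟨K, fun f hf => ⟨(hK f hf).1, fun z Z hz => ?_⟩⟩
    obtain ⟨hsup, hid⟩ := (hK f hf).2 z Z hz
    exact ⟨hsup, fun k ε hk hε _ u L hu hL => hid u _ L (hu.energyClass hΩ hk hε hL)⟩
  · obtain ⟨hloc, hsub⟩ := hseq (b * C) u (fun i => gradient (u i)) _
      (fun i => (h i).1.energyClass hΩ hk hε (h i).2.2.2.1) fun i => (h i).eLpNorm_laplacian_le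
    exact ⟨fun q hq1 hq2 w G hG => hloc q hq1 hq2 G hG.2.1.aestronglyMeasurable, hsub⟩
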